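/- Let $p>1$, let $f,g,\rho\in C[0,1]$ and $d\in C^1(0,1)$ be real functions such that - $\rho>0$ on $(0,1)$ and $\rho(0)=\rho(1)=0$; - $g(0)>0$ and $\int_0^u g(s)\,ds>0$ for every $u\in(0,1]$; - $d>0$ on $(0,1)$ and $\rho\, d^{1/(p-1)}\in L^1(0,1)$. A *travelling wave solution* (t.w.s.) with speed $c\in\mathbb R$ of the equation $f(u)u_x+g(u)u_\tau=[d(u)|u_x|^{p-2}u_x]_x+\rho(u)$ is a function $u\in C^1(\alpha,\beta)$, $-\infty\le\alpha<\beta\le+\infty$, with $0<u<1$ on $(\alpha,\beta)$, $d(u)|u'|^{p-2}u'\in C^1(\alpha,\beta)$, $$(d(u)|u'|^{p-2}u')'+(c\,g(u)-f(u))\,u'+\rho(u)=0\quad\text{on }(\alpha,\beta),$$ $u(t)\to1$ as $t\to\alpha^+$, $u(t)\to0$ as $t\to\beta^-$, and $d(u(t))|u'(t)|^{p-2}u'(t)\to0$ both as $t\to\alpha^+$ and as $t\to\beta^-$. (For $\alpha=-\infty$ or $\beta=+\infty$ these are limits at infinity.) Let $c^*$ be the critical speed, that is, the infimum of the set of all $c\in\mathbb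 R$ for which a t.w.s. with speed $c$ exists. Assume that, as $u\to0^+$, $d(u)\sim k_1u^\delta$ and $\rho(u)\sim k_2u^r$ for some constants $k_1,k_2,r>0$ and $\delta\in\mathbb R$ with $$r\ge\frac{1-\delta}{p-1}.$$ Let $u$ be a t.w.s. with speed $c^*$, defined on $(\alpha,\beta)$. Then: - if $r<1$, then $\beta<+\infty$; - if $r=\frac{1-\delta}{p-1}\ge1$, then $\beta=+\infty$; - if $r>\frac{1-\delta}{p-1}$ and $c^*g(0)>f(0)$, then $\beta<+\infty$ if and only if $\frac{1-\delta}{p-1}<1$. Moreover, if $\beta<+\infty$, then, writing $u'(\beta^-)=\lim_{t\to\beta^-}u'(t)$: - if $\delta<1$, then $u'(\beta^-)$ exists and equals $0$; - if $\delta=1$, then $u'(\beta^-)$ exists in $\mathbb R$, and $u'(\beta^-)=0$ if and only if $c^*g(0)-f(0)=0$; - if $\delta>1$ and $c^*g(0)>f(0)$, then $u'(\beta^-)=-\infty$. -/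

import Mathlib

open Set Filter Topology Asymptotics MeasureTheory

noncomputable section

/-- The real points of the open interval `(α, β)` with extended real end points. -/
def realIoo (α β : EReal) : Set ℝ := {t : ℝ | α < (t : EReal) ∧ (t : EReal) < β}

/-- The filter `t → α⁺` on the real line; for `α = -∞` it is `t → -∞`. -/
def atRightOf (α : EReal) : Filter ℝ := comap (fun t : ℝ => (t : EReal)) (𝓝[>] α)

/-- The filter `t → β⁻` on the real line; for `β = +∞` it is `t → +∞`. -/
def atLeftOf (β : EReal) : Filter ℝ := comap (fun t : ℝ => (t : EReal)) (𝓝[<] β)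

/-- The flux `t ↦ d(u(t)) |u'(t)|^(p-2) u'(t)`. (It is `0` where `u'(t) = 0`, also for `p < 2`.) -/
def flux (p : ℝ) (d u : ℝ → ℝ) (t : ℝ) : ℝ := d (u t) * (|deriv u t| ^ (p - 2) * deriv u t)

/-- `u` is a travelling wave solution with speed `c`, defined on `(α, β)`, of
`f(u) u_x + g(u) u_τ = [d(u) |u_x|^(p-2) u_x]_x + ρ(u)`. -/
structure IsTravellingWave (p : ℝ) (d ρ f g : ℝ → ℝ) (c : ℝ) (α β : EReal) (u : ℝ → ℝ) :
    Prop where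
  lt : α < β
  contDiffOn : ContDiffOn ℝ 1 u (realIoo α β)
  mem_Ioo : ∀ t ∈ realIoo α β, u t ∈ Ioo (0 : ℝ) 1
  contDiffOn_flux : ContDiffOn ℝ 1 (flux p d u) (realIoo α β)
  equation : ∀ t ∈ realIoo α β,
    deriv (flux p d u) t + (c * g (u t) - f (u t)) * deriv u t + ρ (u t) = 0
  tendsto_left : Tendsto u (atRightOf α) (𝓝 1)
  tendsto_right : Tendsto u (atLeftOf β) (𝓝 0)
  flux_left : Tendsto (flux p d u) (atRightOf α) (𝓝 0)
  flux_right : Tendsto (flux p d u) (atLeftOf β) (𝓝 0)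

/-- The set of admissible wave speeds. -/
def waveSpeeds (p : ℝ) (d ρ f g : ℝ → ℝ) : Set ℝ :=
  {c : ℝ | ∃ (α β : EReal) (u : ℝ → ℝ), IsTravellingWave p d ρ f g c α β u}

/-- The threshold (critical) wave speed `c*`. -/
def criticalSpeed (p : ℝ) (d ρ f g : ℝ → ℝ) : ℝ := sInf (waveSpeeds p d ρ f g)

end

/-! A profile `u` is strictly decreasing, so its negated flux is a function `y` of the value `s =
u`, and the equation loses one order. With `q = 1/(p-1)`, `h = c g - f` and `φ = ρ d^q` it reads `y'
= h - φ y^(-q)` on (0,1), with `y > 0` and `y → 0` at both ends; conversely every such `y` produces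
a wave. The inverse `T` of `u` satisfies `T' = -(d/y)^q`, while `u' = -(y(u)/d(u))^q`. So `β` is
finite iff `T` is bounded near 0, and the size of `y/s` at 0 is the main unknown. Put `κ = (1-δ)q`
and `l = c* g(0) - f(0)`.

From above, `y' < h` gives `y ≤ A s`. If `κ ≥ 1` then `-T' ≥ C/s`, hence `β = ∞`; if `l = 0` then
`y/s → 0`.

From below, minimality of `c*` enters: if `κ < r` and `l > 0`, then `y/s → l`
(`tendsto_slope_of_criticalSpeed`). Otherwise `y` lies under a line of slope less than `l` at
arbitrarily small points. Lowering the speed slightly changes `y` only slightly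
(`IsUnitSol.exists_perturbation`), and a line of intermediate slope traps the new solution, which
still vanishes at 0. A speed below `c*` would be admissible. The limit gives `-T' ≤ C s^(-κ)` and
the end slopes.

If `r < 1` no lower bound on `y` is needed: the equation says `ρ·(-T') = h - y'`, and dividing by
`s^r` and integrating by parts bounds `T`. -/

/-! ### Monotonicity and backward comparison -/

theorem monotoneOn_of_hasDerivAt {s : Set ℝ} (hs : Convex ℝ s) {F F' : ℝ → ℝ}
    (hc : ContinuousOn F s) (hd : ∀ x ∈ interior s, HasDerivAt F (F' x) x)
    (hn : ∀ x ∈ interior s, 0 ≤ F' x) : MonotoneOn F s :=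
  monotoneOn_of_deriv_nonneg hs hc (fun x hx => (hd x hx).differentiableAt.differentiableWithinAt)
    fun x hx => (hd x hx).deriv ▸ hn x hx

theorem monotoneOn_Ioo_of_hasDerivAt {a b : ℝ} {F F' : ℝ → ℝ}
    (hd : ∀ x ∈ Ioo a b, HasDerivAt F (F' x) x)
    (hn : ∀ x ∈ Ioo a b, 0 ≤ F' x) : MonotoneOn F (Ioo a b) := by
  apply monotoneOn_of_hasDerivAt (convex_Ioo a b) (F' := F')
  · exact fun x hx => (hd x hx).continuousAt.continuousWithinAt
  · simpa using hd
  · simpa using hn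

/-- A backward comparison principle: where `D` is positive, it grows at least at rate `-K`. -/
theorem le_max_add_of_neg_le_deriv {a b K : ℝ} {D D' : ℝ → ℝ} (hab : a ≤ b) (hK : 0 ≤ K)
    (hc : ContinuousOn D (Icc a b)) (hd : ∀ x ∈ Ioo a b, HasDerivAt D (D' x) x)
    (hn : ∀ x ∈ Ioo a b, 0 < D x → -K ≤ D' x) : D a ≤ max (D b) 0 + K * (b - a) := by
  -- `s` is the first point of `[a, b]` where `D ≤ 0`, or `b` if there is none; the derivative bound
  -- is then available on all of `(a, s)`.
  obtain ⟨s, hs, hDs, hpos⟩ : ∃ s ∈ Icc a b, D s ≤ max (D b) 0 ∧ ∀ x ∈ Ico a s, 0 < D x := by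
    by_cases hne : (Icc a b ∩ D ⁻¹' Iic 0).Nonempty
    · have hcl : IsClosed (Icc a b ∩ D ⁻¹' Iic 0) :=
        hc.preimage_isClosed_of_isClosed isClosed_Icc isClosed_Iic
      have hcp : IsCompact (Icc a b ∩ D ⁻¹' Iic 0) :=
        isCompact_Icc.of_isClosed_subset hcl inter_subset_left
      obtain ⟨s, hs, hmin⟩ := hcp.exists_isLeast hne
      refine ⟨s, hs.1, le_max_of_le_right hs.2, fun x hx => ?_⟩
      by_contra hx0
      exact absurd (hmin ⟨⟨hx.1, hx.2.le.trans hs.1.2⟩, not_lt.1 hx0⟩) (not_le.2 hx.2)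
    · refine ⟨b, right_mem_Icc.2 hab, le_max_left _ _, fun x hx => ?_⟩
      by_contra hx0
      exact hne ⟨x, ⟨hx.1, hx.2.le⟩, not_lt.1 hx0⟩
  have hmono : MonotoneOn (fun x => D x + K * x) (Icc a s) := by
    refine monotoneOn_of_hasDerivAt (convex_Icc a s) (F' := fun x => D' x + K) ?_ ?_ ?_
    · exact (hc.mono (Icc_subset_Icc_right hs.2)).add (by fun_prop)
    · intro x hx
      rw [interior_Icc] at hx
      simpa using (hd x ⟨hx.1, hx.2.trans_le hs.2⟩).fun_add ((hasDerivAt_id x).const_mul K)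
    · intro x hx
      rw [interior_Icc] at hx
      linarith [hn x ⟨hx.1, hx.2.trans_le hs.2⟩ (hpos x ⟨hx.1.le, hx.2⟩)]
  have := hmono (left_mem_Icc.2 hs.1) (right_mem_Icc.2 hs.1) hs.1
  simp only at this
  nlinarith [hs.2]

/-! ### The singular first-order equation on compact intervals -/

/-- `Y` is a positive solution of `Y' = h - φ Y ^ (-q)` on `[a, b]`. -/
structure IsPosSol (q : ℝ) (φ h : ℝ → ℝ) (a b : ℝ) (Y : ℝ → ℝ) : Prop where
  continuousOn : ContinuousOn Y (Icc a b)
  pos : ∀ x ∈ Icc a b, 0 < Y x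
  hasDerivAt : ∀ x ∈ Ioo a b, HasDerivAt Y (h x - φ x * Y x ^ (-q)) x

theorem IsPosSol.mono {q : ℝ} {φ h : ℝ → ℝ} {a b a' b' : ℝ} {Y : ℝ → ℝ}
    (H : IsPosSol q φ h a b Y) (ha : a ≤ a') (hb : b' ≤ b) : IsPosSol q φ h a' b' Y :=
  ⟨H.continuousOn.mono (Icc_subset_Icc ha hb), fun x hx => H.pos x (Icc_subset_Icc ha hb hx),
    fun x hx => H.hasDerivAt x (Ioo_subset_Ioo ha hb hx)⟩

theorem rpow_neg_le_rpow_neg {q x y : ℝ} (hq : 0 ≤ q) (hx : 0 < x) (hxy : x ≤ y) :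
    y ^ (-q) ≤ x ^ (-q) :=
  Real.rpow_le_rpow_of_nonpos hx hxy (by linarith)

/-- The gap between two solutions shrinks backwards. -/
theorem IsPosSol.sub_le {q : ℝ} (hq : 0 ≤ q) {φ h₁ h₂ : ℝ → ℝ} {a b K : ℝ} {Y₁ Y₂ : ℝ → ℝ}
    (hab : a ≤ b) (hK : 0 ≤ K) (hφ : ∀ x ∈ Ioo a b, 0 ≤ φ x) (hh : ∀ x ∈ Ioo a b, h₂ x - h₁ x ≤ K)
    (H₁ : IsPosSol q φ h₁ a b Y₁) (H₂ : IsPosSol q φ h₂ a b Y₂) :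
    Y₁ a - Y₂ a ≤ max (Y₁ b - Y₂ b) 0 + K * (b - a) := by
  refine le_max_add_of_neg_le_deriv (D := fun x => Y₁ x - Y₂ x) hab hK
    (H₁.continuousOn.sub H₂.continuousOn)
    (fun x hx => (H₁.hasDerivAt x hx).sub (H₂.hasDerivAt x hx)) fun x hx hD => ?_
  -- Where `Y₁ > Y₂`, the singular terms contribute `φ (Y₂^(-q) - Y₁^(-q)) ≥ 0` to the derivative of
  -- the gap, so only the drifts can lower it.
  have h1 := rpow_neg_le_rpow_neg hq (H₂.pos x (Ioo_subset_Icc_self hx)) (sub_pos.1 hD).le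
  have := mul_le_mul_of_nonneg_left h1 (hφ x hx)
  linarith [hh x hx]

/-- The truncated nonlinearity is Lipschitz. -/
theorem exists_lipschitzWith_max_rpow (q : ℝ) {η : ℝ} (hη : 0 < η) (hq : 0 ≤ q) :
    ∃ C : NNReal, LipschitzWith C fun y : ℝ => max y η ^ (-q) := by
  let C : NNReal := ⟨q * η ^ (-q - 1), by positivity⟩
  have h1 : LipschitzOnWith C (fun y : ℝ => y ^ (-q)) (Ici η) := by
    refine (convex_Ici η).lipschitzOnWith_of_nnnorm_hasDerivWithin_le
      (f' := fun y => -q * y ^ (-q - 1)) (fun x hx => ?_) fun x hx => ?_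
    · exact (Real.hasDerivAt_rpow_const (Or.inl (hη.trans_le hx).ne')).hasDerivWithinAt
    · rw [← NNReal.coe_le_coe]
      have hx0 : 0 < x := hη.trans_le hx
      rw [coe_nnnorm, Real.norm_eq_abs, abs_mul, abs_neg, abs_of_nonneg hq,
        abs_of_pos (Real.rpow_pos_of_pos hx0 _)]
      exact mul_le_mul_of_nonneg_left
        (Real.rpow_le_rpow_of_nonpos hη hx (by linarith)) hq
  have h2 : LipschitzWith 1 fun y : ℝ => max y η := LipschitzWith.id.max_const η
  refine ⟨C * 1, ?_⟩
  rw [← lipschitzOnWith_univ] at h2 ⊢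
  exact h1.comp h2 fun y _ => le_max_right y η

/-- Backward solvability on compact intervals. -/
theorem exists_isPosSol {q : ℝ} (hq : 0 < q) {φ h : ℝ → ℝ} {a b v : ℝ} (hab : a ≤ b)
    (hφc : ContinuousOn φ (Icc a b)) (hhc : ContinuousOn h (Icc a b))
    (hφ : ∀ x ∈ Icc a b, 0 < φ x) (hv : 0 < v) :
    ∃ Y, IsPosSol q φ h a b Y ∧ Y b = v := by
  have hne : (Icc a b).Nonempty := nonempty_Icc.2 hab
  obtain ⟨x₀, hx₀, hmin⟩ := isCompact_Icc.exists_isMinOn hne hφc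
  obtain ⟨A, hA⟩ := isCompact_Icc.exists_bound_of_continuousOn hhc
  obtain ⟨B, hB⟩ := isCompact_Icc.exists_bound_of_continuousOn hφc
  have hA0 : 0 ≤ A := (norm_nonneg _).trans (hA _ hx₀)
  have hB0 : 0 ≤ B := (norm_nonneg _).trans (hB _ hx₀)
  have hm := hφ x₀ hx₀
  -- At height `η` the singular term beats the drift, so a solution cannot sink below `η` going
  -- backward. Truncating at `η` makes the field bounded and Lipschitz without changing the
  -- solution.
  obtain ⟨η, hη, hηv, hηA⟩ : ∃ η : ℝ, 0 < η ∧ η ≤ v ∧ A ≤ φ x₀ * η ^ (-q) := by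
    have h1 : Tendsto (fun η : ℝ => φ x₀ * η ^ (-q)) (𝓝[>] 0) atTop :=
      (tendsto_rpow_neg_nhdsGT_zero (neg_lt_zero.2 hq)).const_mul_atTop hm
    obtain ⟨η, h2, h3⟩ := ((h1.eventually_ge_atTop A).and (Ioc_mem_nhdsGT hv)).exists
    exact ⟨η, h3.1, h3.2, h2⟩
  obtain ⟨C, hC⟩ := exists_lipschitzWith_max_rpow q hη hq.le
  have hbd : ∀ y : ℝ, |max y η ^ (-q)| ≤ η ^ (-q) := fun y => by
    rw [abs_of_pos (Real.rpow_pos_of_pos (lt_max_of_lt_right hη) _)]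
    exact rpow_neg_le_rpow_neg hq.le hη (le_max_right _ _)
  have hM0 : 0 ≤ A + B * η ^ (-q) := by positivity
  obtain ⟨M, hM⟩ : ∃ M : NNReal, (M : ℝ) = A + B * η ^ (-q) := ⟨⟨_, hM0⟩, rfl⟩
  obtain ⟨R, hR⟩ : ∃ R : NNReal, (R : ℝ) = M * (b - a) :=
    ⟨⟨_, mul_nonneg M.2 (sub_nonneg.2 hab)⟩, rfl⟩
  lift B to NNReal using hB0
  have hpl : IsPicardLindelof (fun t y => h t - φ t * max y η ^ (-q))
      (⟨b, right_mem_Icc.2 hab⟩ : Icc a b) v R 0 M (B * C) := by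
    refine ⟨fun t ht => ?_, fun y _ => ?_, fun t ht y _ => ?_, ?_⟩
    · refine LipschitzWith.lipschitzOnWith (LipschitzWith.of_dist_le_mul fun y z => ?_)
      have h1 := hC.dist_le_mul y z
      rw [Real.dist_eq] at h1 ⊢
      have : h t - φ t * max y η ^ (-q) - (h t - φ t * max z η ^ (-q))
        = -(φ t * (max y η ^ (-q) - max z η ^ (-q))) := by ring
      rw [this, abs_neg, abs_mul, NNReal.coe_mul, mul_assoc]
      exact mul_le_mul (hB t ht) h1 (abs_nonneg _) B.2
    · exact hhc.sub (hφc.mul continuousOn_const)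
    · rw [hM]
      refine (norm_sub_le _ _).trans (add_le_add (hA t ht) ?_)
      rw [norm_mul]
      exact mul_le_mul (hB t ht) (hbd y) (norm_nonneg _) B.2
    · simp [hR, hab]
  obtain ⟨Y, hYb, hY⟩ := hpl.exists_eq_forall_mem_Icc_hasDerivWithinAt₀
  have hYc : ContinuousOn Y (Icc a b) := fun x hx => (hY x hx).continuousWithinAt
  have hYd : ∀ x ∈ Ioo a b, HasDerivAt Y (h x - φ x * max (Y x) η ^ (-q)) x := fun x hx =>
    (hY x (Ioo_subset_Icc_self hx)).hasDerivAt (Icc_mem_nhds hx.1 hx.2)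
  have hge : ∀ x ∈ Icc a b, η ≤ Y x := by
    intro x hx
    have := le_max_add_of_neg_le_deriv (D := fun x => η - Y x) hx.2 le_rfl
      (continuousOn_const.sub (hYc.mono (Icc_subset_Icc_left hx.1)))
      (fun z hz => (hYd z ⟨hx.1.trans_lt hz.1, hz.2⟩).const_sub η) (fun z hz hD => by
        have hz' : z ∈ Icc a b := ⟨hx.1.trans hz.1.le, hz.2.le⟩
        rw [max_eq_right (sub_pos.1 hD).le]
        have h1 := (abs_le.1 (hA z hz')).2
        have h2 := mul_le_mul_of_nonneg_right (hmin hz') (Real.rpow_nonneg hη.le (-q))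
        linarith)
    change Y b = v at hYb
    rw [hYb, max_eq_right (by linarith : η - v ≤ 0)] at this
    linarith
  refine ⟨Y, ⟨hYc, fun x hx => hη.trans_le (hge x hx), fun x hx => ?_⟩, hYb⟩
  have := hYd x hx
  rwa [max_eq_left (hge x (Ioo_subset_Icc_self hx))] at this

theorem exists_rpow_neg_ge (q : ℝ) (hq : 0 < q) {m : ℝ} (hm : 0 < m) (A : ℝ) :
    ∃ η : ℝ, 0 < η ∧ A + η ≤ m * η ^ (-q) := by
  have h1 : Tendsto (fun η : ℝ => m * η ^ (-q)) (𝓝[>] 0) atTop :=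
    (tendsto_rpow_neg_nhdsGT_zero (neg_lt_zero.2 hq)).const_mul_atTop hm
  obtain ⟨η, h2, h3⟩ :=
    ((h1.eventually_ge_atTop (A + 1)).and (Ioc_mem_nhdsGT zero_lt_one)).exists
  exact ⟨η, h3.1, by linarith [h3.2]⟩

/-- Positive solutions on `[a, b]` are bounded away from zero at `a`. -/
theorem IsPosSol.exists_le_left {q : ℝ} (hq : 0 < q) {φ h : ℝ → ℝ} {a b : ℝ} (hab : a < b)
    (hab1 : b ≤ a + 1) (hφc : ContinuousOn φ (Icc a b)) (hhc : ContinuousOn h (Icc a b))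
    (hφ : ∀ x ∈ Icc a b, 0 < φ x) :
    ∃ m : ℝ, 0 < m ∧ ∀ Z, IsPosSol q φ h a b Z → m ≤ Z a := by
  obtain ⟨x₀, hx₀, hmin⟩ := isCompact_Icc.exists_isMinOn (nonempty_Icc.2 hab.le) hφc
  obtain ⟨A, hA⟩ := isCompact_Icc.exists_bound_of_continuousOn hhc
  obtain ⟨η, hη, hηA⟩ := exists_rpow_neg_ge q hq (hφ x₀ hx₀) A
  -- The barrier is the line `η (b - x)`, which vanishes at `b` and stays at most `η` because `b - a
  -- ≤ 1`. Under it, `Z' ≤ A - φ η^(-q) ≤ -η`.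
  refine ⟨η * (b - a), mul_pos hη (sub_pos.2 hab), fun Z hZ => ?_⟩
  have := le_max_add_of_neg_le_deriv (D := fun x => η * (b - x) - Z x) hab.le le_rfl
      ((by fun_prop : ContinuousOn (fun x => η * (b - x)) (Icc a b)).sub hZ.continuousOn)
      (fun z hz => (((hasDerivAt_id z).const_sub b).const_mul η).sub (hZ.hasDerivAt z hz))
      (fun z hz hD => by
        have hz' := Ioo_subset_Icc_self hz
        have hZη : Z z ≤ η := by nlinarith [hz.1, hz.2, sub_pos.1 hD]
        have h1 := (abs_le.1 (hA z hz')).2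
        have h2 := mul_le_mul (hmin hz') (rpow_neg_le_rpow_neg hq.le (hZ.pos z hz') hZη)
          (Real.rpow_nonneg hη.le (-q)) (hφ z hz').le
        linarith)
  have hb := hZ.pos b (right_mem_Icc.2 hab.le)
  rw [max_eq_right (by linarith)] at this
  linarith

/-! ### Solutions on (0,1) under perturbation of the drift -/

/-- `Y` is a positive solution of `Y' = h - φ Y ^ (-q)` on `(0, 1)`. -/
structure IsUnitSol (q : ℝ) (φ h : ℝ → ℝ) (Y : ℝ → ℝ) : Prop where
  pos : ∀ x ∈ Ioo (0 : ℝ) 1, 0 < Y x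
  hasDerivAt : ∀ x ∈ Ioo (0 : ℝ) 1, HasDerivAt Y (h x - φ x * Y x ^ (-q)) x

theorem IsUnitSol.isPosSol {q : ℝ} {φ h : ℝ → ℝ} {Y : ℝ → ℝ} (H : IsUnitSol q φ h Y) {a b : ℝ}
    (ha : 0 < a) (hb : b < 1) : IsPosSol q φ h a b Y where
  continuousOn x hx :=
    (H.hasDerivAt x ⟨ha.trans_le hx.1, hx.2.trans_lt hb⟩).continuousAt.continuousWithinAt
  pos x hx := H.pos x ⟨ha.trans_le hx.1, hx.2.trans_lt hb⟩
  hasDerivAt x hx := H.hasDerivAt x ⟨ha.trans hx.1, hx.2.trans hb⟩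

/-- If `y` is a positive solution and the drift is perturbed by at most `K`, then there is a
positive solution of the perturbed equation which is at most `y x + K (1 - x)`. -/
theorem IsUnitSol.exists_perturbation {q K : ℝ} (hq : 0 < q) (hK : 0 < K) {φ h₀ h y : ℝ → ℝ}
    (hφc : ContinuousOn φ (Ioo 0 1)) (hhc : ContinuousOn h (Ioo 0 1))
    (hφ : ∀ x ∈ Ioo (0 : ℝ) 1, 0 < φ x) (hh : ∀ x ∈ Ioo (0 : ℝ) 1, h₀ x - h x ≤ K)
    (hy : IsUnitSol q φ h₀ y) :
    ∃ Y, IsUnitSol q φ h Y ∧ ∀ x ∈ Ioo (0 : ℝ) 1, Y x ≤ y x + K * (1 - x) := by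
  have hsub : ∀ {a b : ℝ}, 0 < a → b < 1 → Icc a b ⊆ Ioo 0 1 := fun ha hb x hx =>
    ⟨ha.trans_le hx.1, hx.2.trans_lt hb⟩
  -- Start backward from `b < 1` on the supersolution `y + K (1 - x)`, then let `b → 1`. The
  -- implication inside the existential makes `Z` total.
  have hex : ∀ a b : ℝ, ∃ Z, 0 < a → a ≤ b → b < 1 →
      IsPosSol q φ h a b Z ∧ Z b = y b + K * (1 - b) := by
    intro a b
    by_cases hab : 0 < a ∧ a ≤ b ∧ b < 1
    · obtain ⟨ha, hab, hb⟩ := hab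
      have hv : 0 < y b + K * (1 - b) :=
        add_pos (hy.pos b ⟨ha.trans_le hab, hb⟩) (mul_pos hK (sub_pos.2 hb))
      obtain ⟨Z, hZ⟩ := exists_isPosSol hq hab (hφc.mono (hsub ha hb)) (hhc.mono (hsub ha hb))
        (fun x hx => hφ x (hsub ha hb hx)) hv
      exact ⟨Z, fun _ _ _ => hZ⟩
    · exact ⟨0, fun h1 h2 h3 => absurd ⟨h1, h2, h3⟩ hab⟩
  choose Z hZ using hex
  have cmp : ∀ {a b : ℝ} {Y₁ Y₂ : ℝ → ℝ}, 0 < a → a ≤ b → b < 1 → IsPosSol q φ h a b Y₁ →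
      IsPosSol q φ h a b Y₂ → Y₁ a - Y₂ a ≤ max (Y₁ b - Y₂ b) 0 := by
    intro a b Y₁ Y₂ ha hab hb H₁ H₂
    simpa using H₁.sub_le hq.le hab le_rfl
      (fun x hx => (hφ x (hsub ha hb (Ioo_subset_Icc_self hx))).le) (by simp) H₂
  -- `V b x` is the value at `x` of the solution started at `b`; backward uniqueness makes the left
  -- end point of its interval irrelevant.
  let V : ℝ → ℝ → ℝ := fun b x => Z x b x
  have hZV : ∀ {a b x : ℝ}, 0 < a → a ≤ x → x ≤ b → b < 1 → Z a b x = V b x := by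
    intro a b x ha hax hxb hb
    obtain ⟨h1, h2⟩ := hZ a b ha (hax.trans hxb) hb
    obtain ⟨h3, h4⟩ := hZ x b (ha.trans_le hax) hxb hb
    have h5 := cmp (ha.trans_le hax) hxb hb (h1.mono hax le_rfl) h3
    have h6 := cmp (ha.trans_le hax) hxb hb h3 (h1.mono hax le_rfl)
    rw [h2, h4, sub_self, max_self] at h5 h6
    exact le_antisymm (by linarith) (by linarith)
  have hVS : ∀ {x b : ℝ}, 0 < x → x ≤ b → b < 1 → V b x ≤ y x + K * (1 - x) := by
    intro x b hx hxb hb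
    obtain ⟨h3, h4⟩ := hZ x b hx hxb hb
    have h1 := h3.sub_le hq.le hxb hK.le
      (fun z hz => (hφ z (hsub hx hb (Ioo_subset_Icc_self hz))).le)
      (fun z hz => hh z (hsub hx hb (Ioo_subset_Icc_self hz))) (hy.isPosSol hx hb)
    rw [h4, add_sub_cancel_left, max_eq_left (mul_nonneg hK.le (sub_nonneg.2 hb.le))] at h1
    change Z x b x ≤ _
    linarith
  -- A solution started at `b' ≥ b` has, at `b`, dropped below the supersolution, which is where the
  -- one from `b` starts; the order persists backward.
  have hVanti : ∀ {x : ℝ}, 0 < x → AntitoneOn (fun b => V b x) (Ioo x 1) := by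
    intro x hx b hb b' hb' hbb'
    obtain ⟨h1, -⟩ := hZ x b' hx hb'.1.le hb'.2
    obtain ⟨h3, h4⟩ := hZ x b hx hb.1.le hb.2
    have h5 := cmp hx hb.1.le hb.2 (h1.mono le_rfl hbb') h3
    rw [h4, hZV hx hb.1.le hbb' hb'.2,
      max_eq_right (sub_nonpos.2 (hVS (hx.trans hb.1) hbb' hb'.2))] at h5
    exact sub_nonpos.1 h5
  -- A lower bound independent of `b` keeps the limit off the singularity.
  have hVpos : ∀ x ∈ Ioo (0 : ℝ) 1, ∃ m, 0 < m ∧ ∃ b₀ < 1, ∀ b ∈ Ioo b₀ 1, m ≤ V b x := by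
    intro x hx
    have h1 : x < (x + 1) / 2 := by linarith [hx.2]
    have h2 : (x + 1) / 2 < 1 := by linarith [hx.2]
    obtain ⟨m, hm, hm'⟩ := IsPosSol.exists_le_left (q := q) (φ := φ) (h := h) hq h1
      (by linarith [hx.1]) (hφc.mono (hsub hx.1 h2)) (hhc.mono (hsub hx.1 h2))
      (fun z hz => hφ z (hsub hx.1 h2 hz))
    exact ⟨m, hm, _, h2, fun b hb => hm' (Z x b)
      ((hZ x b hx.1 (h1.trans hb.1).le hb.2).1.mono le_rfl hb.1.le)⟩
  have hVlim : ∀ x, ∃ l, x ∈ Ioo (0 : ℝ) 1 → Tendsto (fun b => V b x) (𝓝[<] 1) (𝓝 l) := by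
    intro x
    by_cases hx : x ∈ Ioo (0 : ℝ) 1
    · have := MonotoneOn.tendsto_nhdsWithin_Ioo_left (β := ℝᵒᵈ) (f := fun b => V b x)
        (nonempty_Ioo.2 hx.2) (hVanti hx.1) ⟨(0 : ℝ), by
          rintro _ ⟨b, hb, rfl⟩
          exact ((hZ x b hx.1 hb.1.le hb.2).1.pos x ⟨le_rfl, hb.1.le⟩).le⟩
      exact ⟨_, fun _ => this⟩
    · exact ⟨0, fun h => absurd h hx⟩
  choose Y hY using hVlim
  have hYpos : ∀ x ∈ Ioo (0 : ℝ) 1, 0 < Y x := by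
    intro x hx
    obtain ⟨m, hm, b₀, hb₀, hmb⟩ := hVpos x hx
    exact hm.trans_le (ge_of_tendsto (hY x hx) (mem_of_superset (Ioo_mem_nhdsLT hb₀) hmb))
  -- Backward, gaps do not grow, so pointwise convergence of `V b'` at `b` forces convergence at `a`
  -- to the true solution with end value `Y b`. Hence the limit `Y` solves the equation.
  have hYeq : ∀ {a b : ℝ}, 0 < a → a ≤ b → b < 1 → ∀ W, IsPosSol q φ h a b W → W b = Y b →
      W a = Y a := by
    intro a b ha hab hb W hW hWb
    have hYa := hY a ⟨ha, hab.trans_lt hb⟩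
    have hYb := hY b ⟨ha.trans_le hab, hb⟩
    have key : ∀ b' ∈ Ioo b 1, W a - V b' a ≤ max (Y b - V b' b) 0 ∧
        V b' a - W a ≤ max (V b' b - Y b) 0 := by
      intro b' hb'
      have h1 := (hZ a b' ha (hab.trans hb'.1.le) hb'.2).1.mono le_rfl hb'.1.le
      have h2 := cmp ha hab hb hW h1
      have h3 := cmp ha hab hb h1 hW
      rw [hWb, hZV ha le_rfl (hab.trans hb'.1.le) hb'.2, hZV ha hab hb'.1.le hb'.2] at h2 h3
      exact ⟨h2, h3⟩
    have l1 : Tendsto (fun b' => max (Y b - V b' b) 0) (𝓝[<] 1) (𝓝 0) := by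
      simpa using (hYb.const_sub (Y b)).max (tendsto_const_nhds (x := (0 : ℝ)))
    have l2 : Tendsto (fun b' => max (V b' b - Y b) 0) (𝓝[<] 1) (𝓝 0) := by
      simpa using (hYb.sub_const (Y b)).max (tendsto_const_nhds (x := (0 : ℝ)))
    have h1 := le_of_tendsto_of_tendsto (hYa.const_sub (W a)) l1
      (mem_of_superset (Ioo_mem_nhdsLT hb) fun b' hb' => (key b' hb').1)
    have h2 := le_of_tendsto_of_tendsto (hYa.sub_const (W a)) l2
      (mem_of_superset (Ioo_mem_nhdsLT hb) fun b' hb' => (key b' hb').2)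
    linarith
  refine ⟨Y, ⟨hYpos, fun x hx => ?_⟩, fun x hx => ?_⟩
  · have ha : 0 < x / 2 := by linarith [hx.1]
    have hb : (x + 1) / 2 < 1 := by linarith [hx.2]
    have hax : x / 2 < x := by linarith [hx.1]
    have hxb : x < (x + 1) / 2 := by linarith [hx.2]
    obtain ⟨W, hW, hWb⟩ := exists_isPosSol hq (hax.trans hxb).le (hφc.mono (hsub ha hb))
      (hhc.mono (hsub ha hb)) (fun z hz => hφ z (hsub ha hb hz)) (hYpos _ ⟨hx.1.trans hxb, hb⟩)
    have heq : ∀ z ∈ Ioo (x / 2) ((x + 1) / 2), W z = Y z := fun z hz =>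
      hYeq (ha.trans hz.1) hz.2.le hb W (hW.mono hz.1.le le_rfl) hWb
    have h1 := hW.hasDerivAt x ⟨hax, hxb⟩
    rw [heq x ⟨hax, hxb⟩] at h1
    exact h1.congr_of_eventuallyEq
      (mem_of_superset (Ioo_mem_nhds hax hxb) fun z hz => (heq z hz).symm)
  · exact le_of_tendsto (hY x hx) (mem_of_superset (Ioo_mem_nhdsLT hx.2) fun b hb =>
      hVS hx.1 hb.1.le hb.2)

/-! ### Intervals with extended end points; inverse functions -/

theorem isOpen_realIoo (α β : EReal) : IsOpen (realIoo α β) :=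
  isOpen_Ioo.preimage continuous_coe_real_ereal

theorem ordConnected_realIoo (α β : EReal) : OrdConnected (realIoo α β) :=
  ⟨fun _ hx _ hy _ hz => ⟨hx.1.trans_le (EReal.coe_le_coe_iff.2 hz.1),
    (EReal.coe_le_coe_iff.2 hz.2).trans_lt hy.2⟩⟩

theorem atLeftOf_hasBasis {α β : EReal} (h : α < β) :
    (atLeftOf β).HasBasis (· < β) fun a => realIoo a β :=
  (nhdsLT_basis_of_exists_lt ⟨α, h⟩).comap _

theorem atRightOf_hasBasis {α β : EReal} (h : α < β) :
    (atRightOf α).HasBasis (α < ·) fun b => realIoo α b :=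
  (nhdsGT_basis_of_exists_gt ⟨β, h⟩).comap _

theorem realIoo_nonempty {α β : EReal} (h : α < β) : (realIoo α β).Nonempty :=
  EReal.lt_iff_exists_real_btwn.1 h

theorem atLeftOf_neBot {α β : EReal} (h : α < β) : (atLeftOf β).NeBot :=
  (atLeftOf_hasBasis h).neBot_iff.2 fun h' => realIoo_nonempty h'

theorem atRightOf_neBot {α β : EReal} (h : α < β) : (atRightOf α).NeBot :=
  (atRightOf_hasBasis h).neBot_iff.2 fun h' => realIoo_nonempty h'

theorem eventually_nhdsLT_pos_of_hasDerivAt_neg {w : ℝ → ℝ} {w' s : ℝ} (hw : HasDerivAt w w' s)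
    (h0 : w s = 0) (hw' : w' < 0) : ∀ᶠ z in 𝓝[<] s, 0 < w z := by
  have h1 := (hasDerivAt_iff_tendsto_slope_left_right.1 hw).1
  filter_upwards [h1.eventually_lt_const hw', self_mem_nhdsWithin] with z hz hzs
  rw [slope_def_field, h0, sub_zero] at hz
  by_contra hneg
  exact absurd (div_nonneg_of_nonpos (not_lt.1 hneg) (sub_nonpos.2 (le_of_lt hzs))) (not_le.2 hz)

/-- Inverse of a strictly decreasing function with nonvanishing derivative. -/
theorem StrictAntiOn.exists_hasDerivAt_inverse {f f' : ℝ → ℝ} {S : Set ℝ} (hf : StrictAntiOn f S)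
    (hS : IsOpen S) (hd : ∀ x ∈ S, HasDerivAt f (f' x) x) (h0 : ∀ x ∈ S, f' x ≠ 0)
    (hR : IsOpen (f '' S)) :
    ∃ T : ℝ → ℝ, (∀ r ∈ f '' S, T r ∈ S ∧ f (T r) = r) ∧ (∀ x ∈ S, T (f x) = x) ∧
      StrictAntiOn T (f '' S) ∧ ∀ r ∈ f '' S, HasDerivAt T (f' (T r))⁻¹ r := by
  let T := Function.invFunOn f S
  have h1 : ∀ r ∈ f '' S, T r ∈ S ∧ f (T r) = r := fun r hr =>
    ⟨Function.invFunOn_mem hr, Function.invFunOn_eq hr⟩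
  have h2 : ∀ x ∈ S, T (f x) = x := fun x hx => hf.injOn.leftInvOn_invFunOn hx
  have h3 : StrictAntiOn T (f '' S) := by
    intro r hr s hs hrs
    by_contra hle
    have := hf.antitoneOn (h1 r hr).1 (h1 s hs).1 (not_lt.1 hle)
    rw [(h1 r hr).2, (h1 s hs).2] at this
    exact absurd this (not_le.2 hrs)
  have h4 : T '' (f '' S) = S := by
    ext x
    constructor
    · rintro ⟨r, hr, rfl⟩
      exact (h1 r hr).1
    · exact fun hx => ⟨f x, mem_image_of_mem _ hx, h2 x hx⟩
  refine ⟨T, h1, h2, h3, fun r hr => ?_⟩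
  have hcont : ContinuousAt T r := by
    refine StrictMonoOn.continuousAt_of_image_mem_nhds (β := ℝᵒᵈ) (f := T)
      (fun a ha b hb hab => h3 ha hb hab) (hR.mem_nhds hr) ?_
    have := hS.mem_nhds (h1 r hr).1
    rw [← h4] at this
    exact this
  exact HasDerivAt.of_local_left_inverse hcont (hd _ (h1 r hr).1) (h0 _ (h1 r hr).1)
    (mem_of_superset (hR.mem_nhds hr) fun z hz => (h1 z hz).2)

/-! ### Monotonicity of wave profiles -/

namespace IsTravellingWave

variable {p : ℝ} {d ρ f g : ℝ → ℝ} {c : ℝ} {α β : EReal} {u : ℝ → ℝ}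

theorem hasDerivAt (H : IsTravellingWave p d ρ f g c α β u) {t : ℝ} (ht : t ∈ realIoo α β) :
    HasDerivAt u (deriv u t) t :=
  ((H.contDiffOn.differentiableOn one_ne_zero).differentiableAt
    ((isOpen_realIoo α β).mem_nhds ht)).hasDerivAt

theorem hasDerivAt_flux (H : IsTravellingWave p d ρ f g c α β u) {t : ℝ} (ht : t ∈ realIoo α β) :
    HasDerivAt (flux p d u) (-((c * g (u t) - f (u t)) * deriv u t + ρ (u t))) t := by
  have := ((H.contDiffOn_flux.differentiableOn one_ne_zero).differentiableAt
    ((isOpen_realIoo α β).mem_nhds ht)).hasDerivAt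
  rwa [show deriv (flux p d u) t = -((c * g (u t) - f (u t)) * deriv u t + ρ (u t)) by
    linarith [H.equation t ht]] at this

/-- If `u'(s) ≥ 0`, the flux is positive just left of `s` (when `u'(s) = 0`, because its derivative
there is `-ρ < 0`), so `u` takes smaller values there. But if `u'(t) ≥ 0`, pick `a < t` with `u a >
u t`, possible since `u → 1`: a minimum point of `u` on `[a, t]` lies right of `a` and has
nonnegative slope, a contradiction. -/
theorem deriv_neg (H : IsTravellingWave p d ρ f g c α β u)
    (hρ : ∀ x ∈ Ioo (0 : ℝ) 1, 0 < ρ x) (hd : ∀ x ∈ Ioo (0 : ℝ) 1, 0 < d x) {t : ℝ}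
    (ht : t ∈ realIoo α β) : deriv u t < 0 := by
  by_contra hneg
  have hI := isOpen_realIoo α β
  have pos_of_flux : ∀ z ∈ realIoo α β, 0 < flux p d u z → 0 < deriv u z := by
    intro z hz hw
    by_contra hz'
    refine absurd hw (not_lt.2 (mul_nonpos_of_nonneg_of_nonpos (hd _ (H.mem_Ioo z hz)).le ?_))
    exact mul_nonpos_of_nonneg_of_nonpos (Real.rpow_nonneg (abs_nonneg _) _) (not_lt.1 hz')
  have key : ∀ s ∈ realIoo α β, 0 ≤ deriv u s → ∀ a < s, ∃ z ∈ Ioo a s, u z < u s := by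
    intro s hs h0 a has
    have hev : ∀ᶠ z in 𝓝[<] s, 0 < flux p d u z := by
      rcases h0.eq_or_lt with h0 | h0
      · refine eventually_nhdsLT_pos_of_hasDerivAt_neg (H.hasDerivAt_flux hs) ?_ ?_
        · simp [flux, ← h0]
        · rw [← h0]
          linarith [hρ _ (H.mem_Ioo s hs)]
      · have : 0 < flux p d u s := mul_pos (hd _ (H.mem_Ioo s hs))
          (mul_pos (Real.rpow_pos_of_pos (abs_pos.2 h0.ne') _) h0)
        exact ((H.hasDerivAt_flux hs).continuousAt.eventually_const_lt this).filter_mono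
          nhdsWithin_le_nhds
    have hev2 : ∀ᶠ z in 𝓝[<] s, z ∈ realIoo α β ∧ 0 < flux p d u z :=
      Filter.Eventually.and (mem_nhdsWithin_of_mem_nhds (hI.mem_nhds hs)) hev
    obtain ⟨l, hl, hls⟩ := (mem_nhdsLT_iff_exists_Ioo_subset' has).1 hev2
    have hl : l < s := hl
    obtain ⟨z, hz1, hz2⟩ := exists_between (max_lt has hl)
    refine ⟨z, ⟨(le_max_left _ _).trans_lt hz1, hz2⟩, ?_⟩
    have hlz : l < z := (le_max_right _ _).trans_lt hz1
    have hmem : ∀ x ∈ Icc z s, x ∈ realIoo α β := fun x hx => by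
      rcases hx.2.eq_or_lt with rfl | h
      · exact hs
      · exact (hls ⟨hlz.trans_le hx.1, h⟩).1
    refine strictMonoOn_of_deriv_pos (convex_Icc z s)
      (fun x hx => (H.hasDerivAt (hmem x hx)).continuousAt.continuousWithinAt) (fun x hx => ?_)
      (left_mem_Icc.2 hz2.le) (right_mem_Icc.2 hz2.le) hz2
    rw [interior_Icc] at hx
    exact pos_of_flux x (hmem x (Ioo_subset_Icc_self hx)) (hls ⟨hlz.trans hx.1, hx.2⟩).2
  have := atRightOf_neBot H.lt
  obtain ⟨a, ha, hua⟩ := (Filter.Eventually.and ((atRightOf_hasBasis H.lt).mem_of_mem ht.1)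
    (H.tendsto_left.eventually_const_lt (H.mem_Ioo t ht).2)).exists
  have hat : a < t := EReal.coe_lt_coe_iff.1 ha.2
  have haI : a ∈ realIoo α β := ⟨ha.1, ha.2.trans ht.2⟩
  have hsub : Icc a t ⊆ realIoo α β := (ordConnected_realIoo α β).out haI ht
  obtain ⟨s, hs, hmin⟩ := isCompact_Icc.exists_isMinOn (nonempty_Icc.2 hat.le)
    (fun x hx => (H.hasDerivAt (hsub hx)).continuousAt.continuousWithinAt : ContinuousOn u _)
  have has : a < s := by
    refine lt_of_le_of_ne hs.1 ?_
    rintro rfl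
    exact absurd (hmin (right_mem_Icc.2 hat.le)) (not_le.2 hua)
  have hs0 : 0 ≤ deriv u s := by
    rcases hs.2.eq_or_lt with rfl | h
    · exact not_lt.1 hneg
    · exact ((hmin.isLocalMin (Icc_mem_nhds has h)).deriv_eq_zero).ge
  obtain ⟨z, hz, hzs⟩ := key s (hsub hs) hs0 a has
  exact absurd (hmin ⟨hz.1.le, hz.2.le.trans hs.2⟩) (not_le.2 hzs)

theorem strictAntiOn (H : IsTravellingWave p d ρ f g c α β u)
    (hρ : ∀ x ∈ Ioo (0 : ℝ) 1, 0 < ρ x) (hd : ∀ x ∈ Ioo (0 : ℝ) 1, 0 < d x) :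
    StrictAntiOn u (realIoo α β) := by
  refine strictAntiOn_of_deriv_neg (convex_iff_ordConnected.2 (ordConnected_realIoo α β))
    (fun x hx => (H.hasDerivAt hx).continuousAt.continuousWithinAt) fun x hx => ?_
  rw [(isOpen_realIoo α β).interior_eq] at hx
  exact H.deriv_neg hρ hd hx

theorem exists_lt (H : IsTravellingWave p d ρ f g c α β u) {x : ℝ} (hx : 0 < x) :
    ∃ t ∈ realIoo α β, u t < x := by
  have := atLeftOf_neBot H.lt
  exact (Filter.Eventually.and ((atLeftOf_hasBasis H.lt).mem_of_mem H.lt)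
    (H.tendsto_right.eventually_lt_const hx)).exists

theorem exists_gt (H : IsTravellingWave p d ρ f g c α β u) {x : ℝ} (hx : x < 1) :
    ∃ t ∈ realIoo α β, x < u t := by
  have := atRightOf_neBot H.lt
  exact (Filter.Eventually.and ((atRightOf_hasBasis H.lt).mem_of_mem H.lt)
    (H.tendsto_left.eventually_const_lt hx)).exists

theorem image_eq (H : IsTravellingWave p d ρ f g c α β u) : u '' realIoo α β = Ioo 0 1 := by
  refine Subset.antisymm (image_subset_iff.2 H.mem_Ioo) fun x hx => ?_
  obtain ⟨t₁, ht₁, h₁⟩ := H.exists_lt hx.1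
  obtain ⟨t₂, ht₂, h₂⟩ := H.exists_gt hx.2
  exact (ordConnected_realIoo α β).isPreconnected.intermediate_value ht₁ ht₂
    (fun x hx => (H.hasDerivAt hx).continuousAt.continuousWithinAt) ⟨h₁.le, h₂.le⟩

end IsTravellingWave

/-! ### From waves to the first-order problem -/

theorem abs_rpow_mul_neg {p v : ℝ} (hv : v < 0) : |v| ^ (p - 2) * v = -(-v) ^ (p - 1) := by
  have h : (-v) ^ (p - 1) = (-v) ^ (p - 2) * (-v) := by
    rw [← Real.rpow_add_one (neg_pos.2 hv).ne']
    ring_nf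
  rw [abs_of_neg hv, h]
  ring

/-- The first-order reduction of a travelling wave: the flux as a function of the wave profile. -/
theorem IsTravellingWave.exists_isUnitSol {p : ℝ} {d ρ f g : ℝ → ℝ} {c : ℝ} {α β : EReal}
    {u : ℝ → ℝ} (H : IsTravellingWave p d ρ f g c α β u) (hp : 1 < p)
    (hρ : ∀ x ∈ Ioo (0 : ℝ) 1, 0 < ρ x) (hd : ∀ x ∈ Ioo (0 : ℝ) 1, 0 < d x) :
    ∃ y T : ℝ → ℝ,
      IsUnitSol (1 / (p - 1)) (fun s => ρ s * d s ^ (1 / (p - 1))) (fun s => c * g s - f s) y ∧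
      Tendsto y (𝓝[>] 0) (𝓝 0) ∧ Tendsto y (𝓝[<] 1) (𝓝 0) ∧
      (∀ t ∈ realIoo α β, deriv u t = -(y (u t) / d (u t)) ^ (1 / (p - 1))) ∧
      (∀ s ∈ Ioo (0 : ℝ) 1, HasDerivAt T (-(d s / y s) ^ (1 / (p - 1))) s) ∧
      (∀ s ∈ Ioo (0 : ℝ) 1, T s ∈ realIoo α β) ∧ (∀ t ∈ realIoo α β, T (u t) = t) := by
  have hp1 : 0 < p - 1 := sub_pos.2 hp
  have hanti := H.strictAntiOn hρ hd
  have hneg : ∀ t ∈ realIoo α β, deriv u t < 0 := fun t ht => H.deriv_neg hρ hd ht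
  obtain ⟨T, hT1, hT2, hT3, hT4⟩ := hanti.exists_hasDerivAt_inverse (isOpen_realIoo α β)
    (fun t ht => H.hasDerivAt ht) (fun t ht => (hneg t ht).ne) (by rw [H.image_eq]; exact isOpen_Ioo)
  rw [H.image_eq] at hT1 hT3 hT4
  have hflux : ∀ t ∈ realIoo α β, -flux p d u t = d (u t) * (-deriv u t) ^ (p - 1) := by
    intro t ht
    rw [flux, abs_rpow_mul_neg (hneg t ht)]
    ring
  have hpos : ∀ t ∈ realIoo α β, 0 < -flux p d u t := by
    intro t ht
    rw [hflux t ht]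
    exact mul_pos (hd _ (H.mem_Ioo t ht)) (Real.rpow_pos_of_pos (neg_pos.2 (hneg t ht)) _)
  have hder : ∀ t ∈ realIoo α β, deriv u t = -(-flux p d u t / d (u t)) ^ (1 / (p - 1)) := by
    intro t ht
    rw [hflux t ht, mul_div_cancel_left₀ _ (hd _ (H.mem_Ioo t ht)).ne', one_div,
      Real.rpow_rpow_inv (neg_pos.2 (hneg t ht)).le hp1.ne', neg_neg]
  have hderT : ∀ s ∈ Ioo (0 : ℝ) 1,
      (deriv u (T s))⁻¹ = -(d s / -flux p d u (T s)) ^ (1 / (p - 1)) := by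
    intro s hs
    obtain ⟨h1, h2⟩ := hT1 s hs
    rw [hder _ h1, h2, inv_neg, ← Real.inv_rpow (div_pos (hpos _ h1) (hd s hs)).le, inv_div]
  refine ⟨fun s => -flux p d u (T s), T, ⟨fun s hs => hpos _ (hT1 s hs).1, fun s hs => ?_⟩,
    ?_, ?_, fun t ht => ?_, fun s hs => ?_, fun s hs => (hT1 s hs).1, hT2⟩
  · obtain ⟨h1, h2⟩ := hT1 s hs
    have h3 := ((H.hasDerivAt_flux h1).comp s (hT4 s hs)).neg
    refine h3.congr_deriv ?_
    have h4 : ρ s * d s ^ (1 / (p - 1)) * (-flux p d u (T s)) ^ (-(1 / (p - 1)))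
        = -(ρ s * (deriv u (T s))⁻¹) := by
      rw [hderT s hs, Real.div_rpow (hd s hs).le (hpos _ h1).le, Real.rpow_neg (hpos _ h1).le,
        div_eq_mul_inv]
      ring
    rw [h4, h2]
    field_simp [(hneg _ h1).ne]
    ring
  · have h1 : Tendsto T (𝓝[>] 0) (atLeftOf β) := by
      refine (atLeftOf_hasBasis H.lt).tendsto_right_iff.2 fun a ha => ?_
      obtain ⟨t, ht⟩ := realIoo_nonempty (max_lt ha H.lt)
      have htI : t ∈ realIoo α β := ⟨(le_max_right _ _).trans_lt ht.1, ht.2⟩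
      filter_upwards [Ioo_mem_nhdsGT (H.mem_Ioo t htI).1] with s hs
      have hs1 : s ∈ Ioo (0 : ℝ) 1 := ⟨hs.1, hs.2.trans (H.mem_Ioo t htI).2⟩
      have h2 := hT3 hs1 (H.mem_Ioo t htI) hs.2
      rw [hT2 t htI] at h2
      exact ⟨((le_max_left _ _).trans_lt ht.1).trans (EReal.coe_lt_coe_iff.2 h2),
        (hT1 s hs1).1.2⟩
    simpa using (H.flux_right.comp h1).neg
  · have h1 : Tendsto T (𝓝[<] 1) (atRightOf α) := by
      refine (atRightOf_hasBasis H.lt).tendsto_right_iff.2 fun a ha => ?_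
      obtain ⟨t, ht⟩ := realIoo_nonempty (lt_min ha H.lt)
      have htI : t ∈ realIoo α β := ⟨ht.1, ht.2.trans_le (min_le_right _ _)⟩
      filter_upwards [Ioo_mem_nhdsLT (H.mem_Ioo t htI).2] with s hs
      have hs1 : s ∈ Ioo (0 : ℝ) 1 := ⟨(H.mem_Ioo t htI).1.trans hs.1, hs.2⟩
      have h2 := hT3 (H.mem_Ioo t htI) hs1 hs.1
      rw [hT2 t htI] at h2
      exact ⟨(hT1 s hs1).1.1,
        (EReal.coe_lt_coe_iff.2 h2).trans (ht.2.trans_le (min_le_left _ _))⟩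
    simpa using (H.flux_left.comp h1).neg
  · simp only [hT2 t ht]
    exact hder t ht
  · exact (hT4 s hs).congr_deriv (hderT s hs)

/-! ### From the first-order problem back to waves -/

theorem exists_hasDerivAt_Ioo {a b : ℝ} (hab : a < b) {θ : ℝ → ℝ}
    (hθ : ContinuousOn θ (Ioo a b)) : ∃ T : ℝ → ℝ, ∀ s ∈ Ioo a b, HasDerivAt T (θ s) s := by
  obtain ⟨m, hm⟩ := exists_between hab
  refine ⟨fun s => ∫ x in m..s, θ x, fun s hs => ?_⟩
  exact intervalIntegral.integral_hasDerivAt_right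
    ((hθ.mono (ordConnected_Ioo.uIcc_subset hm hs)).intervalIntegrable)
    (hθ.stronglyMeasurableAtFilter isOpen_Ioo s hs) (hθ.continuousAt (isOpen_Ioo.mem_nhds hs))

theorem StrictAntiOn.isOpen_image_Ioo {a b : ℝ} {T : ℝ → ℝ} (hT : StrictAntiOn T (Ioo a b))
    (hc : ContinuousOn T (Ioo a b)) : IsOpen (T '' Ioo a b) := by
  rw [isOpen_iff_mem_nhds]
  rintro _ ⟨s, hs, rfl⟩
  obtain ⟨s₁, h1⟩ := exists_between hs.1
  obtain ⟨s₂, h2⟩ := exists_between hs.2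
  have hs₁ : s₁ ∈ Ioo a b := ⟨h1.1, h1.2.trans hs.2⟩
  have hs₂ : s₂ ∈ Ioo a b := ⟨hs.1.trans h2.1, h2.2⟩
  have hsub : Icc s₁ s₂ ⊆ Ioo a b := fun x hx => ⟨hs₁.1.trans_le hx.1, hx.2.trans_lt hs₂.2⟩
  refine mem_of_superset (Icc_mem_nhds (hT hs hs₂ h2.1) (hT hs₁ hs h1.2)) ?_
  exact (intermediate_value_Icc' (h1.2.trans h2.1).le (hc.mono hsub)).trans (image_mono hsub)

theorem realIoo_sInf_sSup {R : Set ℝ} (hR : OrdConnected R) (ho : IsOpen R) :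
    realIoo (sInf ((↑) '' R)) (sSup ((↑) '' R)) = R := by
  ext t
  constructor
  · rintro ⟨h1, h2⟩
    obtain ⟨_, ⟨a, ha, rfl⟩, hat⟩ := sInf_lt_iff.1 h1
    obtain ⟨_, ⟨b, hb, rfl⟩, hbt⟩ := lt_sSup_iff.1 h2
    exact hR.out ha hb ⟨(EReal.coe_lt_coe_iff.1 hat).le, (EReal.coe_lt_coe_iff.1 hbt).le⟩
  · intro ht
    obtain ⟨l, r, hlr, hsub⟩ := mem_nhds_iff_exists_Ioo_subset.1 (ho.mem_nhds ht)
    obtain ⟨a, ha⟩ := exists_between hlr.1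
    obtain ⟨b, hb⟩ := exists_between hlr.2
    exact ⟨(sInf_le (mem_image_of_mem _ (hsub ⟨ha.1, ha.2.trans hlr.2⟩))).trans_lt
      (EReal.coe_lt_coe_iff.2 ha.2), (EReal.coe_lt_coe_iff.2 hb.1).trans_le
      (le_sSup (mem_image_of_mem _ (hsub ⟨hlr.1.trans hb.1, hb.2⟩)))⟩

theorem contDiffOn_one_of_hasDerivAt {F F' : ℝ → ℝ} {s : Set ℝ} (hs : IsOpen s)
    (hd : ∀ x ∈ s, HasDerivAt F (F' x) x) (hc : ContinuousOn F' s) : ContDiffOn ℝ 1 F s := by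
  rw [contDiffOn_one_iff_derivWithin hs.uniqueDiffOn]
  refine ⟨fun x hx => (hd x hx).differentiableAt.differentiableWithinAt, hc.congr fun x hx => ?_⟩
  rw [derivWithin_of_isOpen hs hx, (hd x hx).deriv]

/-- A positive solution of the first-order problem vanishing at both ends gives a travelling
wave. -/
theorem IsUnitSol.mem_waveSpeeds {p : ℝ} {d ρ f g : ℝ → ℝ} {c : ℝ} {y : ℝ → ℝ} (hp : 1 < p)
    (hf : ContinuousOn f (Icc 0 1)) (hg : ContinuousOn g (Icc 0 1))
    (hρc : ContinuousOn ρ (Icc 0 1)) (hdc : ContinuousOn d (Ioo 0 1))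
    (hd : ∀ x ∈ Ioo (0 : ℝ) 1, 0 < d x)
    (hy : IsUnitSol (1 / (p - 1)) (fun s => ρ s * d s ^ (1 / (p - 1)))
      (fun s => c * g s - f s) y)
    (h0 : Tendsto y (𝓝[>] 0) (𝓝 0)) (h1 : Tendsto y (𝓝[<] 1) (𝓝 0)) :
    c ∈ waveSpeeds p d ρ f g := by
  have hp1 : 0 < p - 1 := sub_pos.2 hp
  have hyc : ContinuousOn y (Ioo 0 1) := fun x hx =>
    (hy.hasDerivAt x hx).continuousAt.continuousWithinAt
  have hθpos : ∀ s ∈ Ioo (0 : ℝ) 1, 0 < (d s / y s) ^ (1 / (p - 1)) := fun s hs =>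
    Real.rpow_pos_of_pos (div_pos (hd s hs) (hy.pos s hs)) _
  have hθc : ContinuousOn (fun s => -(d s / y s) ^ (1 / (p - 1))) (Ioo 0 1) :=
    ((hdc.div hyc fun s hs => (hy.pos s hs).ne').rpow_const
      fun s hs => Or.inl (div_pos (hd s hs) (hy.pos s hs)).ne').neg
  obtain ⟨T, hT⟩ := exists_hasDerivAt_Ioo zero_lt_one hθc
  have hTc : ContinuousOn T (Ioo 0 1) := fun x hx => (hT x hx).continuousAt.continuousWithinAt
  have hTanti : StrictAntiOn T (Ioo 0 1) := by
    refine strictAntiOn_of_deriv_neg (convex_Ioo 0 1) hTc fun x hx => ?_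
    rw [interior_Ioo] at hx
    rw [(hT x hx).deriv]
    exact neg_lt_zero.2 (hθpos x hx)
  have hRo := hTanti.isOpen_image_Ioo hTc
  have hRc : OrdConnected (T '' Ioo 0 1) := (isPreconnected_Ioo.image T hTc).ordConnected
  obtain ⟨u, hu1, hu2, hu3, hu4⟩ := hTanti.exists_hasDerivAt_inverse isOpen_Ioo hT
    (fun x hx => (neg_lt_zero.2 (hθpos x hx)).ne) hRo
  have hI := realIoo_sInf_sSup hRc hRo
  -- The domain of the wave is the open interval `T '' (0,1)`; its end points may be infinite, hence
  -- the infimum and supremum in `EReal`.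
  set α : EReal := sInf ((↑) '' (T '' Ioo 0 1))
  set β : EReal := sSup ((↑) '' (T '' Ioo 0 1))
  rw [← hI] at hu1 hu3 hu4
  have hTI : ∀ s ∈ Ioo (0 : ℝ) 1, T s ∈ realIoo α β := fun s hs => by
    rw [hI]; exact mem_image_of_mem _ hs
  have hαβ : α < β := by
    have := hTI (1 / 2) (by norm_num)
    exact this.1.trans this.2
  have hud : ∀ t ∈ realIoo α β, HasDerivAt u (-(y (u t) / d (u t)) ^ (1 / (p - 1))) t := by
    intro t ht
    have hs := (hu1 t ht).1
    refine (hu4 t ht).congr_deriv ?_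
    rw [inv_neg, ← Real.inv_rpow (div_pos (hd _ hs) (hy.pos _ hs)).le, inv_div]
  have huc : ContinuousOn u (realIoo α β) := fun t ht =>
    (hud t ht).continuousAt.continuousWithinAt
  have hmaps : MapsTo u (realIoo α β) (Ioo 0 1) := fun t ht => (hu1 t ht).1
  have hu'c : ContinuousOn (fun s => -(y s / d s) ^ (1 / (p - 1))) (Ioo 0 1) :=
    ((hyc.div hdc fun s hs => (hd s hs).ne').rpow_const
      fun s hs => Or.inl (div_pos (hy.pos s hs) (hd s hs)).ne').neg
  have hflux : ∀ t ∈ realIoo α β, flux p d u t = -y (u t) := by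
    intro t ht
    have hs := hmaps ht
    have hq := div_pos (hy.pos _ hs) (hd _ hs)
    rw [flux, (hud t ht).deriv, abs_rpow_mul_neg (neg_lt_zero.2 (Real.rpow_pos_of_pos hq _)),
      neg_neg, one_div, Real.rpow_inv_rpow hq.le hp1.ne', mul_neg,
      mul_div_cancel₀ _ (hd _ hs).ne']
  have hfd : ∀ t ∈ realIoo α β, HasDerivAt (flux p d u)
      (-((c * g (u t) - f (u t)) * -(y (u t) / d (u t)) ^ (1 / (p - 1)) + ρ (u t))) t := by
    intro t ht
    have hs := hmaps ht
    have h2 := ((hy.hasDerivAt _ hs).comp t (hud t ht)).neg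
    have h3 : HasDerivAt (flux p d u) _ t := h2.congr_of_eventuallyEq
      (mem_of_superset ((isOpen_realIoo α β).mem_nhds ht) hflux)
    refine h3.congr_deriv ?_
    have hA := (Real.rpow_pos_of_pos (hd _ hs) (1 / (p - 1))).ne'
    have hB := (Real.rpow_pos_of_pos (hy.pos _ hs) (1 / (p - 1))).ne'
    rw [Real.rpow_neg (hy.pos _ hs).le, Real.div_rpow (hy.pos _ hs).le (hd _ hs).le]
    field_simp
    ring
  have hsub : Ioo (0 : ℝ) 1 ⊆ Icc 0 1 := Ioo_subset_Icc_self
  have hleft : Tendsto u (atRightOf α) (𝓝[<] 1) := by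
    refine ((nhdsLT_basis_of_exists_lt ⟨0, zero_lt_one⟩).tendsto_right_iff).2 fun a ha => ?_
    obtain ⟨s, hs, hs1⟩ := exists_between (max_lt ha zero_lt_one)
    have hsm : s ∈ Ioo (0 : ℝ) 1 := ⟨(le_max_right _ _).trans_lt hs, hs1⟩
    filter_upwards [(atRightOf_hasBasis hαβ).mem_of_mem (hTI s hsm).1] with t ht
    have htI : t ∈ realIoo α β := ⟨ht.1, ht.2.trans (hTI s hsm).2⟩
    have := hu3 htI (hTI s hsm) (EReal.coe_lt_coe_iff.1 ht.2)
    rw [hu2 s hsm] at this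
    exact ⟨((le_max_left _ _).trans_lt hs).trans this, (hmaps htI).2⟩
  have hright : Tendsto u (atLeftOf β) (𝓝[>] 0) := by
    refine ((nhdsGT_basis_of_exists_gt ⟨1, zero_lt_one⟩).tendsto_right_iff).2 fun a ha => ?_
    obtain ⟨s, hs0, hs⟩ := exists_between (lt_min ha zero_lt_one)
    have hsm : s ∈ Ioo (0 : ℝ) 1 := ⟨hs0, hs.trans_le (min_le_right _ _)⟩
    filter_upwards [(atLeftOf_hasBasis hαβ).mem_of_mem (hTI s hsm).2] with t ht
    have htI : t ∈ realIoo α β := ⟨(hTI s hsm).1.trans ht.1, ht.2⟩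
    have := hu3 (hTI s hsm) htI (EReal.coe_lt_coe_iff.1 ht.1)
    rw [hu2 s hsm] at this
    exact ⟨(hmaps htI).1, this.trans (hs.trans_le (min_le_left _ _))⟩
  refine ⟨α, β, u, hαβ, ?_, hmaps, ?_, ?_, hleft.mono_right nhdsWithin_le_nhds,
    hright.mono_right nhdsWithin_le_nhds, ?_, ?_⟩
  · exact contDiffOn_one_of_hasDerivAt (isOpen_realIoo α β) hud (hu'c.comp huc hmaps)
  · refine contDiffOn_one_of_hasDerivAt (isOpen_realIoo α β) hfd ?_
    have h2 : ContinuousOn (fun s => -((c * g s - f s) * -(y s / d s) ^ (1 / (p - 1)) + ρ s))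
        (Ioo 0 1) := (((((hg.mono hsub).const_mul c).sub (hf.mono hsub)).mul hu'c).add
          (hρc.mono hsub)).neg
    exact h2.comp huc hmaps
  · intro t ht
    rw [(hfd t ht).deriv, (hud t ht).deriv]
    ring
  · have h2 : Tendsto (fun t => -y (u t)) (atRightOf α) (𝓝 0) := by
      simpa using (h1.comp hleft).neg
    exact h2.congr' (mem_of_superset ((atRightOf_hasBasis hαβ).mem_of_mem hαβ)
      fun t ht => (hflux t ht).symm)
  · have h2 : Tendsto (fun t => -y (u t)) (atLeftOf β) (𝓝 0) := by
      simpa using (h0.comp hright).neg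
    exact h2.congr' (mem_of_superset ((atLeftOf_hasBasis hαβ).mem_of_mem hαβ)
      fun t ht => (hflux t ht).symm)

theorem exists_forall_Ioo_of_eventually_nhdsGT {P : ℝ → Prop} (h : ∀ᶠ s in 𝓝[>] (0 : ℝ), P s) :
    ∃ s₀ ∈ Ioo (0 : ℝ) 1, ∀ s ∈ Ioc 0 s₀, P s := by
  obtain ⟨b, hb, hsub⟩ := (mem_nhdsGT_iff_exists_Ioo_subset' (zero_lt_one' ℝ)).1 h
  have hb : 0 < b := hb
  obtain ⟨s₀, h0, h1⟩ := exists_between (lt_min hb zero_lt_one)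
  exact ⟨s₀, ⟨h0, h1.trans_le (min_le_right _ _)⟩, fun s hs =>
    hsub ⟨hs.1, hs.2.trans_lt (h1.trans_le (min_le_left _ _))⟩⟩

/-! ### Behaviour at 0 and perturbation of the speed -/

namespace IsUnitSol

variable {q : ℝ} {φ h y : ℝ → ℝ}

/-- A solution vanishing at `0` lies below every line whose slope exceeds the drift. -/
theorem le_mul (hy : IsUnitSol q φ h y) (hφ : ∀ x ∈ Ioo (0 : ℝ) 1, 0 < φ x)
    (h0 : Tendsto y (𝓝[>] 0) (𝓝 0)) {A s₀ : ℝ} (hs₀ : s₀ < 1) (hA : ∀ s ∈ Ioc 0 s₀, h s ≤ A) :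
    ∀ s ∈ Ioc 0 s₀, y s ≤ A * s := by
  intro s hs
  have hmono : MonotoneOn (fun x => A * x - y x) (Ioc 0 s₀) := by
    have hmem : ∀ x ∈ Ioc 0 s₀, x ∈ Ioo (0 : ℝ) 1 := fun x hx => ⟨hx.1, hx.2.trans_lt hs₀⟩
    refine monotoneOn_of_hasDerivAt (convex_Ioc 0 s₀)
      (F' := fun x => A * 1 - (h x - φ x * y x ^ (-q))) (fun x hx => ?_) (fun x hx => ?_)
      fun x hx => ?_
    · exact (((hasDerivAt_id x).const_mul A).sub
        (hy.hasDerivAt x (hmem x hx))).continuousAt.continuousWithinAt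
    · exact ((hasDerivAt_id x).const_mul A).sub (hy.hasDerivAt x (hmem x (interior_subset hx)))
    · have hx := interior_subset hx
      have h1 := mul_pos (hφ x (hmem x hx)) (Real.rpow_pos_of_pos (hy.pos x (hmem x hx)) (-q))
      linarith [hA x hx]
  have hlim : Tendsto (fun x => A * x - y x) (𝓝[>] 0) (𝓝 0) := by
    have h1 : Tendsto (fun x : ℝ => A * x) (𝓝[>] 0) (𝓝 (A * 0)) :=
      ((continuous_const_mul A).tendsto 0).mono_left nhdsWithin_le_nhds
    simpa using h1.sub h0
  have := le_of_tendsto hlim (mem_of_superset (Ioo_mem_nhdsGT hs.1) fun x hx =>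
    hmono ⟨hx.1, hx.2.le.trans hs.2⟩ hs hx.2.le)
  linarith

/-- The limsup of `y/s` at 0 is at most `l`; this holds at every speed, unlike the matching lower
bound. -/
theorem eventually_le_mul (hy : IsUnitSol q φ h y) (hφ : ∀ x ∈ Ioo (0 : ℝ) 1, 0 < φ x)
    (h0 : Tendsto y (𝓝[>] 0) (𝓝 0)) {l A : ℝ} (hh : Tendsto h (𝓝[>] 0) (𝓝 l)) (hA : l < A) :
    ∀ᶠ s in 𝓝[>] 0, y s ≤ A * s := by
  obtain ⟨s₀, hs₀, hs⟩ := exists_forall_Ioo_of_eventually_nhdsGT (hh.eventually_le_const hA)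
  exact mem_of_superset (Ioc_mem_nhdsGT hs₀.1) (hy.le_mul hφ h0 hs₀.2 hs)

theorem zero_le_drift (hy : IsUnitSol q φ h y) (hφ : ∀ x ∈ Ioo (0 : ℝ) 1, 0 < φ x)
    (h0 : Tendsto y (𝓝[>] 0) (𝓝 0)) {l : ℝ} (hh : Tendsto h (𝓝[>] 0) (𝓝 l)) : 0 ≤ l := by
  by_contra hl
  obtain ⟨s, hs, hs1⟩ := ((hy.eventually_le_mul hφ h0 hh (not_le.1 hl)).and
    (Ioo_mem_nhdsGT zero_lt_one)).exists
  rw [zero_mul] at hs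
  exact absurd (hy.pos s hs1) (not_lt.2 hs)

/-- The mean drift of a solution vanishing at both ends is nonnegative. -/
theorem zero_le_integral (hy : IsUnitSol q φ h y) (hφ : ∀ x ∈ Ioo (0 : ℝ) 1, 0 < φ x)
    (hh : ContinuousOn h (Icc 0 1)) (h0 : Tendsto y (𝓝[>] 0) (𝓝 0))
    (h1 : Tendsto y (𝓝[<] 1) (𝓝 0)) : 0 ≤ ∫ x in (0 : ℝ)..1, h x := by
  have hint : IntervalIntegrable h volume 0 1 :=
    (hh.mono (by rw [uIcc_of_le zero_le_one])).intervalIntegrable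
  have hPc : ContinuousOn (fun s => ∫ x in (0 : ℝ)..s, h x) (Icc 0 1) := by
    simpa [uIcc_of_le (zero_le_one' ℝ)] using
      intervalIntegral.continuousOn_primitive_interval' hint left_mem_uIcc
  have hPd : ∀ s ∈ Ioo (0 : ℝ) 1, HasDerivAt (fun s => ∫ x in (0 : ℝ)..s, h x) (h s) s := by
    intro s hs
    refine intervalIntegral.integral_hasDerivAt_right (hint.mono_set ?_)
      ((hh.mono Ioo_subset_Icc_self).stronglyMeasurableAtFilter isOpen_Ioo s hs)
      (hh.continuousAt (Icc_mem_nhds hs.1 hs.2))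
    rw [uIcc_of_le hs.1.le, uIcc_of_le zero_le_one]
    exact Icc_subset_Icc_right hs.2.le
  have hmono : MonotoneOn (fun s => (∫ x in (0 : ℝ)..s, h x) - y s) (Ioo 0 1) :=
    monotoneOn_Ioo_of_hasDerivAt (fun s hs => (hPd s hs).sub (hy.hasDerivAt s hs)) fun s hs => by
      have := mul_pos (hφ s hs) (Real.rpow_pos_of_pos (hy.pos s hs) (-q))
      linarith
  have hl0 : Tendsto (fun s => (∫ x in (0 : ℝ)..s, h x) - y s) (𝓝[>] 0) (𝓝 0) := by
    have := ((hPc 0 (left_mem_Icc.2 zero_le_one)).tendsto.mono_left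
      (nhdsWithin_le_of_mem (Icc_mem_nhdsGT zero_lt_one))).sub h0
    simpa using this
  have hl1 : Tendsto (fun s => (∫ x in (0 : ℝ)..s, h x) - y s) (𝓝[<] 1)
      (𝓝 (∫ x in (0 : ℝ)..1, h x)) := by
    have := ((hPc 1 (right_mem_Icc.2 zero_le_one)).tendsto.mono_left
      (nhdsWithin_le_of_mem (Icc_mem_nhdsLT zero_lt_one))).sub h1
    simpa using this
  have hm : (1 / 2 : ℝ) ∈ Ioo (0 : ℝ) 1 := by norm_num
  have e1 := le_of_tendsto hl0 (mem_of_superset (Ioo_mem_nhdsGT hm.1) fun s hs =>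
    hmono ⟨hs.1, hs.2.trans hm.2⟩ hm hs.2.le)
  have e2 := ge_of_tendsto hl1 (mem_of_superset (Ioo_mem_nhdsLT hm.2) fun s hs =>
    hmono hm ⟨hm.1.trans hs.1, hs.2⟩ hs.1.le)
  exact e1.trans e2

/-- A linear supersolution near `0` bounds a solution from above. -/
theorem le_mul_of_le (hy : IsUnitSol q φ h y) (hq : 0 ≤ q) (hφ : ∀ x ∈ Ioo (0 : ℝ) 1, 0 < φ x)
    {L s₀ : ℝ} (hL : 0 < L) (hs₀ : s₀ < 1)
    (hb : ∀ s ∈ Ioc 0 s₀, L + φ s * (L * s) ^ (-q) ≤ h s) (hys : y s₀ ≤ L * s₀) :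
    ∀ s ∈ Ioc 0 s₀, y s ≤ L * s := by
  intro s hs
  have hmem : ∀ x ∈ Ioc 0 s₀, x ∈ Ioo (0 : ℝ) 1 := fun x hx => ⟨hx.1, hx.2.trans_lt hs₀⟩
  have hP := hy.isPosSol hs.1 hs₀
  have := le_max_add_of_neg_le_deriv (D := fun x => y x - L * x) hs.2 le_rfl
    (hP.continuousOn.sub (by fun_prop))
    (fun x hx => (hP.hasDerivAt x hx).sub ((hasDerivAt_id x).const_mul L)) fun x hx hD => by
      have hx' : x ∈ Ioc 0 s₀ := ⟨hs.1.trans hx.1, hx.2.le⟩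
      have h1 := rpow_neg_le_rpow_neg hq (mul_pos hL hx'.1) (sub_pos.1 hD).le
      have h2 := mul_le_mul_of_nonneg_left h1 (hφ x (hmem x hx')).le
      linarith [hb x hx']
  rw [max_eq_right (sub_nonpos.2 hys)] at this
  linarith

/-- If the slope at `0` is not the maximal one, then the drift can be decreased. -/
theorem exists_drift_sub {k : ℝ → ℝ} (hy : IsUnitSol q φ h y) (hq : 0 < q)
    (hφc : ContinuousOn φ (Ioo 0 1)) (hφ : ∀ x ∈ Ioo (0 : ℝ) 1, 0 < φ x)
    (hhc : ContinuousOn h (Ioo 0 1)) (hk : ContinuousOn k (Icc 0 1))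
    (h0 : Tendsto y (𝓝[>] 0) (𝓝 0)) (h1 : Tendsto y (𝓝[<] 1) (𝓝 0)) {l : ℝ} (hl : 0 < l)
    (hh : Tendsto h (𝓝[>] 0) (𝓝 l)) (hφ0 : Tendsto (fun s => φ s * s ^ (-q)) (𝓝[>] 0) (𝓝 0))
    (hslope : ¬ Tendsto (fun s => y s / s) (𝓝[>] 0) (𝓝 l)) :
    ∃ e : ℝ, 0 < e ∧ ∃ Y, IsUnitSol q φ (fun s => h s - e * k s) Y ∧
      Tendsto Y (𝓝[>] 0) (𝓝 0) ∧ Tendsto Y (𝓝[<] 1) (𝓝 0) := by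
  have hpos : ∀ᶠ s : ℝ in 𝓝[>] 0, 0 < s := self_mem_nhdsWithin
  -- Since `y/s` cannot exceed `l` in the limit, failure to converge means dipping under a line of
  -- slope `l - ε` at arbitrarily small points.
  obtain ⟨ε, hε, hεl, hfreq⟩ : ∃ ε, 0 < ε ∧ ε < l ∧ ∃ᶠ s in 𝓝[>] 0, y s ≤ (l - ε) * s := by
    by_contra hcon
    push Not at hcon
    refine hslope (tendsto_order.2 ⟨fun a ha => ?_, fun a ha => ?_⟩)
    · have h2 : 0 < min (l - a) (l / 2) := lt_min (sub_pos.2 ha) (half_pos hl)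
      filter_upwards [hcon _ h2 ((min_le_right _ _).trans_lt (half_lt_self hl)), hpos]
        with s hs hs0
      rw [lt_div_iff₀ hs0]
      refine lt_of_le_of_lt (mul_le_mul_of_nonneg_right ?_ hs0.le) hs
      linarith [min_le_left (l - a) (l / 2)]
    · obtain ⟨b, hb⟩ := exists_between ha
      filter_upwards [hy.eventually_le_mul hφ h0 hh hb.1, hpos] with s hs hs0
      rw [div_lt_iff₀ hs0]
      exact hs.trans_lt (mul_lt_mul_of_pos_right hb.2 hs0)
  -- The barrier slope is `l - ε/2`. The oscillation of `h`, the singular term and the speed change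
  -- cost at most `ε/8` each, less than the available `ε/2`.
  have hL : 0 < l - ε / 2 := by linarith
  have hev1 : ∀ᶠ s in 𝓝[>] 0, l - ε / 8 ≤ h s := hh.eventually_const_le (by linarith)
  have hev2 : ∀ᶠ s in 𝓝[>] 0, φ s * ((l - ε / 2) * s) ^ (-q) ≤ ε / 8 := by
    have h2 := (hφ0.const_mul ((l - ε / 2) ^ (-q))).eventually_le_const
      (show (l - ε / 2) ^ (-q) * 0 < ε / 8 by linarith [mul_zero ((l - ε / 2) ^ (-q))])
    filter_upwards [h2, hpos] with s hs hs0
    rw [Real.mul_rpow hL.le hs0.le]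
    linarith
  obtain ⟨s₁, hs₁, hs₁'⟩ := exists_forall_Ioo_of_eventually_nhdsGT (hev1.and hev2)
  obtain ⟨s₀, hys₀, hs₀⟩ := (hfreq.and_eventually (Ioc_mem_nhdsGT hs₁.1)).exists
  have hs₀1 : s₀ < 1 := hs₀.2.trans_lt hs₁.2
  obtain ⟨M, hM⟩ := isCompact_Icc.exists_bound_of_continuousOn hk
  have hM0 : 0 ≤ M := (norm_nonneg _).trans (hM 0 (left_mem_Icc.2 zero_le_one))
  have hK : 0 < ε / 8 * s₀ := by have := hs₀.1; positivity
  have he : 0 < ε / 8 * s₀ / (M + 1) := by positivity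
  -- The factor `s₀` keeps the perturbed solution under the barrier at `s₀`: `(l - ε) s₀ + (ε/8) s₀
  -- ≤ (l - ε/2) s₀`. Only an upper bound on `e k` is needed, so `k` may change sign.
  set e := ε / 8 * s₀ / (M + 1)
  have heM : ∀ x ∈ Icc (0 : ℝ) 1, e * k x ≤ ε / 8 * s₀ := by
    intro x hx
    have h2 : k x ≤ M + 1 := (le_abs_self _).trans ((hM x hx).trans (by linarith))
    calc e * k x ≤ e * (M + 1) := mul_le_mul_of_nonneg_left h2 he.le
      _ = ε / 8 * s₀ := div_mul_cancel₀ _ (by positivity)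
  obtain ⟨Y, hY, hYle⟩ := hy.exists_perturbation (h := fun s => h s - e * k s) hq hK hφc
    (hhc.sub ((hk.mono Ioo_subset_Icc_self).const_mul e)) hφ
    (fun x hx => by
      have := heM x (Ioo_subset_Icc_self hx)
      linarith)
  refine ⟨e, he, Y, hY, ?_, ?_⟩
  · have hlin := hY.le_mul_of_le hq.le hφ hL hs₀1 (fun s hs => by
      obtain ⟨h2, h3⟩ := hs₁' s ⟨hs.1, hs.2.trans hs₀.2⟩
      have h4 := heM s ⟨hs.1.le, hs.2.trans hs₀1.le⟩
      have h5 : ε / 8 * s₀ ≤ ε / 8 := by nlinarith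
      linarith) (by
      have h2 := hYle s₀ ⟨hs₀.1, hs₀1⟩
      have h3 : ε / 8 * s₀ * (1 - s₀) ≤ ε / 8 * s₀ := by nlinarith [hs₀.1]
      nlinarith [hs₀.1])
    have hlim : Tendsto (fun s => (l - ε / 2) * s) (𝓝[>] 0) (𝓝 0) := by
      have := ((continuous_const_mul (l - ε / 2)).tendsto 0).mono_left
        (nhdsWithin_le_nhds (s := Ioi 0))
      simpa using this
    refine tendsto_of_tendsto_of_tendsto_of_le_of_le' tendsto_const_nhds hlim ?_ ?_
    · exact mem_of_superset (Ioo_mem_nhdsGT zero_lt_one) fun s hs => (hY.pos s hs).le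
    · exact mem_of_superset (Ioc_mem_nhdsGT hs₀.1) hlin
  · have hlim : Tendsto (fun s => y s + ε / 8 * s₀ * (1 - s)) (𝓝[<] 1) (𝓝 0) := by
      have h2 : Continuous fun s : ℝ => ε / 8 * s₀ * (1 - s) := by fun_prop
      simpa using h1.add ((h2.tendsto 1).mono_left nhdsWithin_le_nhds)
    refine tendsto_of_tendsto_of_tendsto_of_le_of_le' tendsto_const_nhds hlim ?_ ?_
    · exact mem_of_superset (Ioo_mem_nhdsLT zero_lt_one) fun s hs => (hY.pos s hs).le
    · exact mem_of_superset (Ioo_mem_nhdsLT zero_lt_one) hYle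

end IsUnitSol

/-! ### The critical speed -/

/-- Integrating `y' ≤ c g - f` over (0,1), with `y` vanishing at both ends, gives `∫ f ≤ c ∫ g`.
Without a lower bound, `sInf` would be a default value and minimality would say nothing. -/
theorem bddBelow_waveSpeeds {p : ℝ} (hp : 1 < p) {d ρ f g : ℝ → ℝ}
    (hf : ContinuousOn f (Icc 0 1)) (hg : ContinuousOn g (Icc 0 1))
    (hρ : ∀ x ∈ Ioo (0 : ℝ) 1, 0 < ρ x) (hd : ∀ x ∈ Ioo (0 : ℝ) 1, 0 < d x)
    (hgint : 0 < ∫ s in (0 : ℝ)..1, g s) : BddBelow (waveSpeeds p d ρ f g) := by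
  refine ⟨(∫ s in (0 : ℝ)..1, f s) / ∫ s in (0 : ℝ)..1, g s, ?_⟩
  rintro c ⟨α, β, u, H⟩
  obtain ⟨y, T, hy, h0, h1, -⟩ := H.exists_isUnitSol hp hρ hd
  have h2 := hy.zero_le_integral
    (fun x hx => mul_pos (hρ x hx) (Real.rpow_pos_of_pos (hd x hx) _))
    ((hg.const_mul c).sub hf) h0 h1
  have hfi : IntervalIntegrable f volume 0 1 :=
    (hf.mono (by rw [uIcc_of_le zero_le_one])).intervalIntegrable
  have hgi : IntervalIntegrable g volume 0 1 :=
    (hg.mono (by rw [uIcc_of_le zero_le_one])).intervalIntegrable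
  rw [intervalIntegral.integral_sub (hgi.const_mul c) hfi,
    intervalIntegral.integral_const_mul] at h2
  rw [div_le_iff₀ hgint]
  linarith

/-- At the critical speed, the first-order profile has the maximal slope at `0`. -/
theorem tendsto_slope_of_criticalSpeed {p : ℝ} (hp : 1 < p) {d ρ f g : ℝ → ℝ}
    (hf : ContinuousOn f (Icc 0 1)) (hg : ContinuousOn g (Icc 0 1))
    (hρc : ContinuousOn ρ (Icc 0 1)) (hdc : ContinuousOn d (Ioo 0 1))
    (hρ : ∀ x ∈ Ioo (0 : ℝ) 1, 0 < ρ x) (hd : ∀ x ∈ Ioo (0 : ℝ) 1, 0 < d x)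
    (hgint : 0 < ∫ s in (0 : ℝ)..1, g s)
    (hφ0 : Tendsto (fun s => ρ s * d s ^ (1 / (p - 1)) * s ^ (-(1 / (p - 1)))) (𝓝[>] 0) (𝓝 0))
    {c : ℝ} (hc : c = criticalSpeed p d ρ f g) {y : ℝ → ℝ}
    (hy : IsUnitSol (1 / (p - 1)) (fun s => ρ s * d s ^ (1 / (p - 1)))
      (fun s => c * g s - f s) y)
    (h0 : Tendsto y (𝓝[>] 0) (𝓝 0)) (h1 : Tendsto y (𝓝[<] 1) (𝓝 0)) (hl : f 0 < c * g 0) :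
    Tendsto (fun s => y s / s) (𝓝[>] 0) (𝓝 (c * g 0 - f 0)) := by
  have hsub : Ioo (0 : ℝ) 1 ⊆ Icc 0 1 := Ioo_subset_Icc_self
  have hhc : ContinuousOn (fun s => c * g s - f s) (Icc 0 1) := (hg.const_mul c).sub hf
  by_contra hslope
  obtain ⟨e, he, Y, hY, hY0, hY1⟩ := hy.exists_drift_sub
    (one_div_pos.2 (sub_pos.2 hp))
    ((hρc.mono hsub).mul (hdc.rpow_const fun x hx => Or.inl (hd x hx).ne'))
    (fun x hx => mul_pos (hρ x hx) (Real.rpow_pos_of_pos (hd x hx) _)) (hhc.mono hsub) hg h0 h1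
    (sub_pos.2 hl) ((hhc 0 (left_mem_Icc.2 zero_le_one)).mono_left
      (nhdsWithin_le_of_mem (Icc_mem_nhdsGT zero_lt_one))) hφ0 hslope
  have hmem : c - e ∈ waveSpeeds p d ρ f g := by
    refine IsUnitSol.mem_waveSpeeds hp hf hg hρc hdc hd ?_ hY0 hY1
    have : (fun s => (c - e) * g s - f s) = fun s => c * g s - f s - e * g s := by
      funext s; ring
    rwa [this]
  have := csInf_le (bddBelow_waveSpeeds hp hf hg hρ hd hgint) hmem
  rw [hc, criticalSpeed] at this
  linarith

/-! ### Power asymptotics of the coefficients -/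

theorem tendsto_div_rpow_of_isEquivalent {F : ℝ → ℝ} {k a : ℝ}
    (h : F ~[𝓝[>] 0] fun u => k * u ^ a) : Tendsto (fun u => F u / u ^ a) (𝓝[>] 0) (𝓝 k) := by
  obtain ⟨v, hv, hFv⟩ := h.exists_eq_mul
  have h1 : Tendsto (fun u => v u * k) (𝓝[>] 0) (𝓝 k) := by simpa using hv.mul_const k
  refine h1.congr' ?_
  filter_upwards [hFv, self_mem_nhdsWithin] with u hu hu0
  have : u ^ a ≠ 0 := (Real.rpow_pos_of_pos hu0 a).ne'
  rw [hu, Pi.mul_apply]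
  field_simp

theorem eventually_mul_rpow_le_of_isEquivalent {F : ℝ → ℝ} {k a : ℝ} (hk : 0 < k)
    (h : F ~[𝓝[>] 0] fun u => k * u ^ a) : ∀ᶠ u in 𝓝[>] 0, k / 2 * u ^ a ≤ F u := by
  filter_upwards [(tendsto_div_rpow_of_isEquivalent h).eventually_const_le (half_lt_self hk),
    self_mem_nhdsWithin] with u hu hu0
  rwa [le_div_iff₀ (Real.rpow_pos_of_pos hu0 a)] at hu

theorem eventually_le_mul_rpow_of_isEquivalent {F : ℝ → ℝ} {k a : ℝ} (hk : 0 < k)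
    (h : F ~[𝓝[>] 0] fun u => k * u ^ a) : ∀ᶠ u in 𝓝[>] 0, F u ≤ 2 * k * u ^ a := by
  filter_upwards [(tendsto_div_rpow_of_isEquivalent h).eventually_le_const
    (show k < 2 * k by linarith), self_mem_nhdsWithin] with u hu hu0
  rwa [div_le_iff₀ (Real.rpow_pos_of_pos hu0 a)] at hu

theorem tendsto_rpow_nhdsGT_zero_of_pos {a : ℝ} (ha : 0 < a) :
    Tendsto (fun s : ℝ => s ^ a) (𝓝[>] 0) (𝓝 0) := by
  have := ((Real.continuousAt_rpow_const 0 a (Or.inr ha.le)).tendsto).mono_left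
    (nhdsWithin_le_nhds (s := Ioi 0))
  rwa [Real.zero_rpow ha.ne'] at this

/-- The coefficient of the singular term is negligible when `κ < r`. -/
theorem tendsto_singular_coefficient {d ρ : ℝ → ℝ} {q k₁ k₂ r δ : ℝ} (hk₁ : 0 < k₁)
    (hd : ∀ x ∈ Ioo (0 : ℝ) 1, 0 < d x)
    (hd_asymp : d ~[𝓝[>] 0] fun u => k₁ * u ^ δ)
    (hρ_asymp : ρ ~[𝓝[>] 0] fun u => k₂ * u ^ r) (hrδ : (1 - δ) * q < r) :
    Tendsto (fun s => ρ s * d s ^ q * s ^ (-q)) (𝓝[>] 0) (𝓝 0) := by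
  have h1 := (tendsto_div_rpow_of_isEquivalent hρ_asymp).mul
    (((tendsto_div_rpow_of_isEquivalent hd_asymp).rpow_const (p := q) (Or.inl hk₁.ne')).mul
      (tendsto_rpow_nhdsGT_zero_of_pos (sub_pos.2 hrδ)))
  rw [mul_zero, mul_zero] at h1
  refine h1.congr' ?_
  filter_upwards [Ioo_mem_nhdsGT (zero_lt_one' ℝ)] with s hs
  have e1 : s ^ (r - (1 - δ) * q) = s ^ r * (s ^ δ) ^ q * s ^ (-q) := by
    rw [← Real.rpow_mul hs.1.le, ← Real.rpow_add hs.1, ← Real.rpow_add hs.1]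
    ring_nf
  have e2 := (Real.rpow_pos_of_pos hs.1 r).ne'
  have e3 := (Real.rpow_pos_of_pos (Real.rpow_pos_of_pos hs.1 δ) q).ne'
  rw [e1, Real.div_rpow (hd s hs).le (Real.rpow_pos_of_pos hs.1 δ).le]
  field_simp

/-! ### Finite or infinite right end point -/

section EndPoint

variable {T θ : ℝ → ℝ}

/-- If `T' = -θ` with `θ` integrable like a power above `-1`, then `T` is bounded near `0`. -/
theorem exists_bound_of_le_rpow (hT : ∀ s ∈ Ioo (0 : ℝ) 1, HasDerivAt T (-θ s) s) {C κ : ℝ}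
    (hC : 0 ≤ C) (hκ : κ < 1) (hθ : ∀ᶠ s in 𝓝[>] 0, θ s ≤ C * s ^ (-κ)) :
    ∃ s₀ ∈ Ioo (0 : ℝ) 1, ∃ B, ∀ s ∈ Ioc 0 s₀, T s ≤ B := by
  obtain ⟨s₀, hs₀, hs₀'⟩ := exists_forall_Ioo_of_eventually_nhdsGT hθ
  have hκ' : 0 < 1 - κ := sub_pos.2 hκ
  have hder : ∀ s ∈ Ioc 0 s₀, HasDerivAt (fun s => T s + C / (1 - κ) * s ^ (1 - κ))
      (-θ s + C * s ^ (-κ)) s := by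
    intro s hs
    refine ((hT s ⟨hs.1, hs.2.trans_lt hs₀.2⟩).add
      ((Real.hasDerivAt_rpow_const (p := 1 - κ) (Or.inl hs.1.ne')).const_mul
        (C / (1 - κ)))).congr_deriv ?_
    rw [show 1 - κ - 1 = -κ by ring]
    field_simp
  have hmono := monotoneOn_of_hasDerivAt (convex_Ioc 0 s₀)
    (fun s hs => (hder s hs).continuousAt.continuousWithinAt)
    (fun s hs => hder s (interior_subset hs))
    fun s hs => by linarith [hs₀' s (interior_subset hs)]
  refine ⟨s₀, hs₀, T s₀ + C / (1 - κ) * s₀ ^ (1 - κ), fun s hs => ?_⟩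
  have h1 := hmono hs (right_mem_Ioc.2 hs₀.1) hs.2
  have h2 : 0 ≤ C / (1 - κ) * s ^ (1 - κ) :=
    mul_nonneg (div_nonneg hC hκ'.le) (Real.rpow_nonneg hs.1.le _)
  simp only at h1
  linarith

/-- If `T' = -θ` with `θ ≥ C / s`, then `T` is unbounded near `0`. -/
theorem exists_lt_of_inv_le (hT : ∀ s ∈ Ioo (0 : ℝ) 1, HasDerivAt T (-θ s) s) {C : ℝ}
    (hC : 0 < C) (hθ : ∀ᶠ s in 𝓝[>] 0, C * s⁻¹ ≤ θ s) (B : ℝ) :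
    ∃ s ∈ Ioo (0 : ℝ) 1, B < T s := by
  obtain ⟨s₀, hs₀, hs₀'⟩ := exists_forall_Ioo_of_eventually_nhdsGT hθ
  have hder : ∀ s ∈ Ioc 0 s₀, HasDerivAt (fun s => -(T s + C * Real.log s))
      (-(-θ s + C * s⁻¹)) s := fun s hs =>
    ((hT s ⟨hs.1, hs.2.trans_lt hs₀.2⟩).add
      ((Real.hasDerivAt_log hs.1.ne').const_mul C)).neg
  have hmono := monotoneOn_of_hasDerivAt (convex_Ioc 0 s₀)
    (fun s hs => (hder s hs).continuousAt.continuousWithinAt)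
    (fun s hs => hder s (interior_subset hs))
    fun s hs => by linarith [hs₀' s (interior_subset hs)]
  have hlog : Tendsto (fun s => C * Real.log s) (𝓝[>] 0) atBot :=
    Real.tendsto_log_nhdsGT_zero.const_mul_atBot hC
  obtain ⟨s, hs1, hs2⟩ := ((hlog.eventually_lt_atBot (T s₀ + C * Real.log s₀ - B)).and
    (Ioc_mem_nhdsGT hs₀.1)).exists
  refine ⟨s, ⟨hs2.1, hs2.2.trans_lt hs₀.2⟩, ?_⟩
  have h1 := hmono hs2 (right_mem_Ioc.2 hs₀.1) hs2.2
  simp only at h1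
  linarith

end EndPoint

/-- If `β = ∞`, a time beyond both `B` and `T s₀` is attained as `T s` with `s ≤ s₀`, against the
bound. -/
theorem IsTravellingWave.lt_top_of_bound {p : ℝ} {d ρ f g : ℝ → ℝ} {c : ℝ} {α β : EReal}
    {u T : ℝ → ℝ} (H : IsTravellingWave p d ρ f g c α β u)
    (hanti : StrictAntiOn T (Ioo 0 1))
    (hTI : ∀ s ∈ Ioo (0 : ℝ) 1, T s ∈ realIoo α β) (hTu : ∀ t ∈ realIoo α β, T (u t) = t)
    (hB : ∃ s₀ ∈ Ioo (0 : ℝ) 1, ∃ B, ∀ s ∈ Ioc 0 s₀, T s ≤ B) : β < ⊤ := by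
  obtain ⟨s₀, hs₀, B, hB⟩ := hB
  by_contra hβ
  have hβ : β = ⊤ := not_lt_top_iff.1 hβ
  have hlt : T s₀ < max B (T s₀) + 1 := by linarith [le_max_right B (T s₀)]
  have ht : max B (T s₀) + 1 ∈ realIoo α β :=
    ⟨(hTI s₀ hs₀).1.trans (EReal.coe_lt_coe_iff.2 hlt), by rw [hβ]; exact EReal.coe_lt_top _⟩
  have hmem := H.mem_Ioo _ ht
  have hu : u (max B (T s₀) + 1) ≤ s₀ := by
    by_contra hcon
    have := hanti hs₀ hmem (not_le.1 hcon)
    rw [hTu _ ht] at this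
    exact absurd this hlt.not_gt
  have := hB _ ⟨hmem.1, hu⟩
  rw [hTu _ ht] at this
  linarith [le_max_left B (T s₀)]

theorem eq_top_of_unbounded {α β : EReal} {T : ℝ → ℝ}
    (hTI : ∀ s ∈ Ioo (0 : ℝ) 1, T s ∈ realIoo α β)
    (hB : ∀ B : ℝ, ∃ s ∈ Ioo (0 : ℝ) 1, B < T s) : β = ⊤ := by
  by_contra hβ
  obtain ⟨B, hβB, -⟩ := EReal.lt_iff_exists_real_btwn.1 (lt_top_iff_ne_top.2 hβ)
  obtain ⟨s, hs, hBs⟩ := hB B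
  exact absurd ((hTI s hs).2.trans hβB) (EReal.coe_lt_coe_iff.2 hBs).not_gt

/-- For a reaction term of order less than one, the wave reaches `0` in finite time. -/
theorem IsUnitSol.exists_bound_of_lt_one {q : ℝ} {d ρ h y T : ℝ → ℝ} {k₂ r A : ℝ}
    (hy : IsUnitSol q (fun s => ρ s * d s ^ q) h y) (hk₂ : 0 < k₂) (hr : 0 < r) (hr1 : r < 1)
    (hA : 0 < A) (hd : ∀ x ∈ Ioo (0 : ℝ) 1, 0 < d x)
    (hhA : ∀ s ∈ Ioo (0 : ℝ) 1, h s ≤ A) (hyA : ∀ᶠ s in 𝓝[>] 0, y s ≤ A * s)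
    (hρ_low : ∀ᶠ s in 𝓝[>] 0, k₂ / 2 * s ^ r ≤ ρ s)
    (hT : ∀ s ∈ Ioo (0 : ℝ) 1, HasDerivAt T (-(d s / y s) ^ q) s) :
    ∃ s₀ ∈ Ioo (0 : ℝ) 1, ∃ B, ∀ s ∈ Ioc 0 s₀, T s ≤ B := by
  obtain ⟨s₀, hs₀, hs₀'⟩ := exists_forall_Ioo_of_eventually_nhdsGT (hyA.and hρ_low)
  have hr' : 0 < 1 - r := sub_pos.2 hr1
  have hmem : ∀ s ∈ Ioc 0 s₀, s ∈ Ioo (0 : ℝ) 1 := fun s hs => ⟨hs.1, hs.2.trans_lt hs₀.2⟩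
  -- With `θ = (d/y)^q`, the equation gives `θ ≤ (2/k₂) s^(-r) (h - y')`. The function added to `T`
  -- is a primitive of a majorant: the `y'` part is integrated by parts, and the leftover `r y
  -- s^(-r-1)` has the favourable sign.
  have hder : ∀ s ∈ Ioc 0 s₀, HasDerivAt
      (fun s => T s + 2 / k₂ * (A / (1 - r) * s ^ (1 - r) - y s * s ^ (-r)))
      (-(d s / y s) ^ q + 2 / k₂ * (A * s ^ (-r) -
        ((h s - ρ s * (d s / y s) ^ q) * s ^ (-r) + y s * (-r * s ^ (-r - 1))))) s := by
    intro s hs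
    have h1 := (Real.hasDerivAt_rpow_const (p := 1 - r) (Or.inl hs.1.ne')).const_mul (A / (1 - r))
    have h2 := (hy.hasDerivAt s (hmem s hs)).mul
      (Real.hasDerivAt_rpow_const (p := -r) (Or.inl hs.1.ne'))
    refine ((hT s (hmem s hs)).add ((h1.sub h2).const_mul (2 / k₂))).congr_deriv ?_
    have hys := hy.pos s (hmem s hs)
    rw [show 1 - r - 1 = -r by ring, Real.rpow_neg hys.le,
      Real.div_rpow (hd s (hmem s hs)).le hys.le]
    field_simp
  have hnn : ∀ s ∈ Ioc 0 s₀, 0 ≤ -(d s / y s) ^ q + 2 / k₂ * (A * s ^ (-r) -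
        ((h s - ρ s * (d s / y s) ^ q) * s ^ (-r) + y s * (-r * s ^ (-r - 1)))) := by
    intro s hs
    have hθ := Real.rpow_nonneg (div_pos (hd s (hmem s hs)) (hy.pos s (hmem s hs))).le q
    set θ := (d s / y s) ^ q
    have hsr : s ^ r * s ^ (-r) = 1 := by
      rw [← Real.rpow_add hs.1, add_neg_cancel, Real.rpow_zero]
    have hsn := Real.rpow_pos_of_pos hs.1 (-r)
    have h1 : θ ≤ 2 / k₂ * (ρ s * θ * s ^ (-r)) := by
      have h2 := mul_le_mul_of_nonneg_right (hs₀' s hs).2 (mul_nonneg hθ hsn.le)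
      have h3 : k₂ / 2 * s ^ r * (θ * s ^ (-r)) = k₂ / 2 * θ := by
        linear_combination k₂ / 2 * θ * hsr
      rw [h3] at h2
      calc θ = 2 / k₂ * (k₂ / 2 * θ) := by field_simp
        _ ≤ 2 / k₂ * (ρ s * (θ * s ^ (-r))) := mul_le_mul_of_nonneg_left h2 (by positivity)
        _ = 2 / k₂ * (ρ s * θ * s ^ (-r)) := by ring
    have h4 : 0 ≤ 2 / k₂ * ((A - h s) * s ^ (-r) + y s * (r * s ^ (-r - 1))) := by
      have h5 := mul_nonneg (sub_nonneg.2 (hhA s (hmem s hs))) hsn.le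
      have h6 := hy.pos s (hmem s hs)
      have h7 := Real.rpow_pos_of_pos hs.1 (-r - 1)
      positivity
    linarith
  have hmono := monotoneOn_of_hasDerivAt (convex_Ioc 0 s₀)
    (fun s hs => (hder s hs).continuousAt.continuousWithinAt)
    (fun s hs => hder s (interior_subset hs)) (fun s hs => hnn s (interior_subset hs))
  refine ⟨s₀, hs₀, T s₀ + 2 / k₂ * (A / (1 - r) * s₀ ^ (1 - r) - y s₀ * s₀ ^ (-r)) + 2 / k₂ * A,
    fun s hs => ?_⟩
  have h1 := hmono hs (right_mem_Ioc.2 hs₀.1) hs.2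
  have h2 : y s * s ^ (-r) ≤ A := by
    calc y s * s ^ (-r) ≤ A * s * s ^ (-r) :=
          mul_le_mul_of_nonneg_right (hs₀' s hs).1 (Real.rpow_nonneg hs.1.le _)
      _ = A * s ^ (1 - r) := by
          rw [mul_assoc, sub_eq_add_neg, Real.rpow_add hs.1, Real.rpow_one]
      _ ≤ A * 1 := mul_le_mul_of_nonneg_left
          (Real.rpow_le_one hs.1.le (hmem s hs).2.le hr'.le) hA.le
      _ = A := mul_one A
  have h3 : 0 ≤ A / (1 - r) * s ^ (1 - r) :=
    mul_nonneg (div_pos hA hr').le (Real.rpow_nonneg hs.1.le _)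
  have h4 : 2 / k₂ * -A ≤ 2 / k₂ * (A / (1 - r) * s ^ (1 - r) - y s * s ^ (-r)) :=
    mul_le_mul_of_nonneg_left (by linarith) (by positivity)
  simp only at h1
  linarith

theorem mul_rpow_div_mul_rpow {a b s δ q : ℝ} (ha : 0 ≤ a) (hb : 0 < b) (hs : 0 < s) :
    (a * s ^ δ / (b * s)) ^ q = (a / b) ^ q * s ^ ((δ - 1) * q) := by
  rw [Real.rpow_mul hs.le, ← Real.mul_rpow (div_nonneg ha hb.le) (Real.rpow_nonneg hs.le _),
    Real.rpow_sub_one hs.ne']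
  congr 1
  field_simp

/-! ### Comparison of `y` with `d` near 0 -/

section Slope

variable {d y : ℝ → ℝ} {k₁ δ q : ℝ}

/-- The wave slope in terms of the profile slope. -/
theorem tendsto_div_of_isEquivalent (hd_asymp : d ~[𝓝[>] 0] fun u => k₁ * u ^ δ) (hk₁ : 0 < k₁)
    (hδ : δ = 1) {l : ℝ} (hl : Tendsto (fun s => y s / s) (𝓝[>] 0) (𝓝 l)) :
    Tendsto (fun s => y s / d s) (𝓝[>] 0) (𝓝 (l / k₁)) := by
  refine (hl.div (tendsto_div_rpow_of_isEquivalent hd_asymp) hk₁.ne').congr' ?_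
  filter_upwards [self_mem_nhdsWithin] with s hs
  have hs : (s : ℝ) ≠ 0 := ne_of_gt hs
  rw [Pi.div_apply, hδ, Real.rpow_one, div_div_div_cancel_right₀ hs]

theorem tendsto_div_zero_of_le_mul (hd_asymp : d ~[𝓝[>] 0] fun u => k₁ * u ^ δ) (hk₁ : 0 < k₁)
    (hδ : δ < 1) {A : ℝ} (hyA : ∀ᶠ s in 𝓝[>] 0, 0 < y s ∧ y s ≤ A * s) :
    Tendsto (fun s => y s / d s) (𝓝[>] 0) (𝓝 0) := by
  have h1 : Tendsto (fun s : ℝ => A / (k₁ / 2) * s ^ (1 - δ)) (𝓝[>] 0) (𝓝 0) := by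
    simpa using (tendsto_rpow_nhdsGT_zero_of_pos (sub_pos.2 hδ)).const_mul (A / (k₁ / 2))
  have h2 := eventually_mul_rpow_le_of_isEquivalent hk₁ hd_asymp
  refine tendsto_of_tendsto_of_tendsto_of_le_of_le' tendsto_const_nhds h1 ?_ ?_
  · filter_upwards [h2, hyA, self_mem_nhdsWithin] with s hs hys hs0
    have := Real.rpow_pos_of_pos hs0 δ
    exact div_nonneg hys.1.le (le_trans (by positivity) hs)
  · filter_upwards [h2, hyA, self_mem_nhdsWithin] with s hs hys hs0
    have h3 : 0 < s ^ δ := Real.rpow_pos_of_pos hs0 δ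
    have h4 : 0 < k₁ / 2 * s ^ δ := by positivity
    refine (div_le_div₀ (hys.1.le.trans hys.2) hys.2 h4 hs).trans_eq ?_
    rw [Real.rpow_sub hs0, Real.rpow_one]
    field_simp

theorem tendsto_div_atTop_of_mul_le (hd_asymp : d ~[𝓝[>] 0] fun u => k₁ * u ^ δ) (hk₁ : 0 < k₁)
    (hd : ∀ x ∈ Ioo (0 : ℝ) 1, 0 < d x) (hδ : 1 < δ) {a : ℝ} (ha : 0 < a)
    (hya : ∀ᶠ s in 𝓝[>] 0, a * s ≤ y s) :
    Tendsto (fun s => y s / d s) (𝓝[>] 0) atTop := by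
  have h1 : Tendsto (fun s : ℝ => a / (2 * k₁) * s ^ (1 - δ)) (𝓝[>] 0) atTop :=
    (tendsto_rpow_neg_nhdsGT_zero (sub_neg.2 hδ)).const_mul_atTop (by positivity)
  refine tendsto_atTop_mono' _ ?_ h1
  filter_upwards [eventually_le_mul_rpow_of_isEquivalent hk₁ hd_asymp, hya,
    Ioo_mem_nhdsGT (zero_lt_one' ℝ)] with s hs hys hs0
  have h2 : 0 < a * s := mul_pos ha hs0.1
  refine Eq.trans_le ?_ (div_le_div₀ (h2.le.trans hys) hys (hd s hs0) hs)
  rw [Real.rpow_sub hs0.1, Real.rpow_one]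
  field_simp

/-- `d/y` is at least of order `s^(δ-1)`, so its `q`-th power is at least of order `s^(-κ)`, which
dominates `1/s` when `κ ≥ 1`. -/
theorem eventually_mul_inv_le_rpow (hd_asymp : d ~[𝓝[>] 0] fun u => k₁ * u ^ δ) (hk₁ : 0 < k₁)
    (hq : 0 ≤ q) (hκ : 1 ≤ (1 - δ) * q) {A : ℝ} (hA : 0 < A)
    (hyA : ∀ᶠ s in 𝓝[>] 0, 0 < y s ∧ y s ≤ A * s) :
    ∀ᶠ s in 𝓝[>] 0, (k₁ / 2 / A) ^ q * s⁻¹ ≤ (d s / y s) ^ q := by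
  filter_upwards [eventually_mul_rpow_le_of_isEquivalent hk₁ hd_asymp, hyA,
    Ioo_mem_nhdsGT (zero_lt_one' ℝ)] with s hs hys hs0
  have h1 : 0 ≤ k₁ / 2 * s ^ δ := mul_nonneg (half_pos hk₁).le (Real.rpow_nonneg hs0.1.le _)
  calc (k₁ / 2 / A) ^ q * s⁻¹ ≤ (k₁ / 2 / A) ^ q * s ^ ((δ - 1) * q) := by
        refine mul_le_mul_of_nonneg_left ?_ (by positivity)
        rw [← Real.rpow_neg_one]
        exact Real.rpow_le_rpow_of_exponent_ge hs0.1 hs0.2.le (by linarith)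
    _ = (k₁ / 2 * s ^ δ / (A * s)) ^ q :=
        (mul_rpow_div_mul_rpow (half_pos hk₁).le hA hs0.1).symm
    _ ≤ (d s / y s) ^ q := Real.rpow_le_rpow (div_nonneg h1 (mul_pos hA hs0.1).le)
        (div_le_div₀ (h1.trans hs) hs hys.1 hys.2) hq

theorem eventually_rpow_le_mul_rpow (hd_asymp : d ~[𝓝[>] 0] fun u => k₁ * u ^ δ) (hk₁ : 0 < k₁)
    (hd : ∀ x ∈ Ioo (0 : ℝ) 1, 0 < d x) (hq : 0 ≤ q) {a : ℝ} (ha : 0 < a)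
    (hya : ∀ᶠ s in 𝓝[>] 0, a * s ≤ y s) :
    ∀ᶠ s in 𝓝[>] 0, (d s / y s) ^ q ≤ (2 * k₁ / a) ^ q * s ^ (-((1 - δ) * q)) := by
  filter_upwards [eventually_le_mul_rpow_of_isEquivalent hk₁ hd_asymp, hya,
    Ioo_mem_nhdsGT (zero_lt_one' ℝ)] with s hs hys hs0
  have h2 : 0 < a * s := mul_pos ha hs0.1
  rw [show -((1 - δ) * q) = (δ - 1) * q by ring,
    ← mul_rpow_div_mul_rpow (by positivity) ha hs0.1]
  exact Real.rpow_le_rpow (div_pos (hd s hs0) (h2.trans_le hys)).le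
    (div_le_div₀ ((hd s hs0).le.trans hs) hs h2 hys) hq

end Slope

/-! ### The main theorem -/

theorem corollary5p4
    (p : ℝ) (hp : 1 < p) (d ρ f g : ℝ → ℝ)
    -- regularity of the coefficients
    (hf : ContinuousOn f (Icc 0 1)) (hg : ContinuousOn g (Icc 0 1))
    (hρ : ContinuousOn ρ (Icc 0 1)) (hd : ContDiffOn ℝ 1 d (Ioo 0 1))
    -- mono-stable reaction term
    (hρ_pos : ∀ u ∈ Ioo (0 : ℝ) 1, 0 < ρ u) (hρ_zero : ρ 0 = 0) (hρ_one : ρ 1 = 0)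
    -- accumulation term
    (hg_zero : 0 < g 0) (hg_int : ∀ u ∈ Ioc (0 : ℝ) 1, 0 < ∫ s in (0 : ℝ)..u, g s)
    -- diffusion term
    (hd_pos : ∀ u ∈ Ioo (0 : ℝ) 1, 0 < d u)
    (hd_int : IntegrableOn (fun u => ρ u * d u ^ (1 / (p - 1))) (Ioo 0 1) volume)
    -- behaviour of the coefficients at the equilibrium 0
    (k₁ k₂ r δ : ℝ) (hk₁ : 0 < k₁) (hk₂ : 0 < k₂) (hr : 0 < r)
    (hd_asymp : d ~[𝓝[>] 0] fun u => k₁ * u ^ δ)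
    (hρ_asymp : ρ ~[𝓝[>] 0] fun u => k₂ * u ^ r)
    (hrδ : (1 - δ) / (p - 1) ≤ r)
    -- a travelling wave solution having the critical speed
    (α β : EReal) (u : ℝ → ℝ)
    (hu : IsTravellingWave p d ρ f g (criticalSpeed p d ρ f g) α β u) :
    (r < 1 → β < ⊤) ∧
    (r = (1 - δ) / (p - 1) → 1 ≤ r → β = ⊤) ∧
    ((1 - δ) / (p - 1) < r → f 0 < criticalSpeed p d ρ f g * g 0 →
      (β < ⊤ ↔ (1 - δ) / (p - 1) < 1)) ∧
    (β < ⊤ →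
      (δ < 1 → Tendsto (deriv u) (atLeftOf β) (𝓝 0)) ∧
      (δ = 1 → ∃ s : ℝ, Tendsto (deriv u) (atLeftOf β) (𝓝 s) ∧
        (s = 0 ↔ criticalSpeed p d ρ f g * g 0 - f 0 = 0)) ∧
      (1 < δ → f 0 < criticalSpeed p d ρ f g * g 0 →
        Tendsto (deriv u) (atLeftOf β) atBot)) := by
  obtain ⟨y, T, hy, h0, h1, hu', hT, hTI, hTu⟩ := hu.exists_isUnitSol hp hρ_pos hd_pos
  have slope_of_lt := fun hκ hl => tendsto_slope_of_criticalSpeed hp hf hg hρ hd.continuousOn hρ_pos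
    hd_pos (hg_int 1 (right_mem_Ioc.2 zero_lt_one))
    (tendsto_singular_coefficient hk₁ hd_pos hd_asymp hρ_asymp hκ) rfl hy h0 h1 hl
  set c := criticalSpeed p d ρ f g
  have hq : 0 < 1 / (p - 1) := one_div_pos.2 (sub_pos.2 hp)
  rw [← mul_one_div (1 - δ)] at hrδ ⊢
  set q := 1 / (p - 1)
  have hφ : ∀ x ∈ Ioo (0 : ℝ) 1, 0 < ρ x * d x ^ q := fun x hx =>
    mul_pos (hρ_pos x hx) (Real.rpow_pos_of_pos (hd_pos x hx) _)
  have hhc : ContinuousOn (fun s => c * g s - f s) (Icc 0 1) := (hg.const_mul c).sub hf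
  have hh : Tendsto (fun s => c * g s - f s) (𝓝[>] 0) (𝓝 (c * g 0 - f 0)) :=
    (hhc 0 (left_mem_Icc.2 zero_le_one)).mono_left
      (nhdsWithin_le_of_mem (Icc_mem_nhdsGT zero_lt_one))
  obtain ⟨A, hA, hhA⟩ : ∃ A : ℝ, 0 < A ∧ ∀ s ∈ Ioo (0 : ℝ) 1, c * g s - f s ≤ A := by
    obtain ⟨A, hA⟩ := isCompact_Icc.exists_bound_of_continuousOn hhc
    have hA0 : 0 ≤ A := (norm_nonneg _).trans (hA 0 (left_mem_Icc.2 zero_le_one))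
    exact ⟨A + 1, by linarith, fun s hs =>
      (le_abs_self _).trans ((hA s (Ioo_subset_Icc_self hs)).trans (by linarith))⟩
  have hyA : ∀ᶠ s in 𝓝[>] 0, 0 < y s ∧ y s ≤ A * s :=
    mem_of_superset (Ioc_mem_nhdsGT (show (0 : ℝ) < 1 / 2 by norm_num)) fun s hs =>
      ⟨hy.pos s ⟨hs.1, by linarith [hs.2]⟩, hy.le_mul hφ h0 (by norm_num)
        (fun s hs => hhA s ⟨hs.1, by linarith [hs.2]⟩) s hs⟩
  have hl0 : 0 ≤ c * g 0 - f 0 := hy.zero_le_drift hφ h0 hh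
  have hTanti : StrictAntiOn T (Ioo 0 1) := by
    refine strictAntiOn_of_deriv_neg (convex_Ioo 0 1)
      (fun x hx => (hT x hx).continuousAt.continuousWithinAt) fun x hx => ?_
    rw [interior_Ioo] at hx
    rw [(hT x hx).deriv]
    exact neg_lt_zero.2 (Real.rpow_pos_of_pos (div_pos (hd_pos x hx) (hy.pos x hx)) _)
  have top_of_le : 1 ≤ (1 - δ) * q → β = ⊤ := fun hκ =>
    eq_top_of_unbounded hTI (exists_lt_of_inv_le hT
      (Real.rpow_pos_of_pos (div_pos (half_pos hk₁) hA) q)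
      (eventually_mul_inv_le_rpow hd_asymp hk₁ hq.le hκ hA hyA))
  have lower_of_lt : (1 - δ) * q < r → f 0 < c * g 0 →
      ∀ᶠ s in 𝓝[>] 0, (c * g 0 - f 0) / 2 * s ≤ y s := by
    intro hκ hl
    filter_upwards [(slope_of_lt hκ hl).eventually_const_le (half_lt_self (sub_pos.2 hl)),
      self_mem_nhdsWithin] with s hs hs0
    rwa [le_div_iff₀ hs0] at hs
  have hright : Tendsto u (atLeftOf β) (𝓝[>] 0) :=
    tendsto_nhdsWithin_iff.2 ⟨hu.tendsto_right, mem_of_superset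
      ((atLeftOf_hasBasis hu.lt).mem_of_mem hu.lt) fun t ht => (hu.mem_Ioo t ht).1⟩
  have deriv_tendsto : ∀ {F : Filter ℝ}, Tendsto (fun s => -(y s / d s) ^ q) (𝓝[>] 0) F →
      Tendsto (deriv u) (atLeftOf β) F := fun hF =>
    (hF.comp hright).congr' (mem_of_superset ((atLeftOf_hasBasis hu.lt).mem_of_mem hu.lt)
      fun t ht => (hu' t ht).symm)
  refine ⟨fun hr1 => ?_, fun hrκ hr1 => top_of_le (hrκ ▸ hr1), fun hκ hl => ⟨fun hβ => ?_,
    fun hκ1 => ?_⟩, fun _ => ⟨fun hδ => deriv_tendsto ?_, fun hδ => ?_, fun hδ hl =>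
    deriv_tendsto ?_⟩⟩
  · exact hu.lt_top_of_bound hTanti hTI hTu (hy.exists_bound_of_lt_one hk₂ hr hr1 hA hd_pos hhA
      (hyA.mono fun s hs => hs.2) (eventually_mul_rpow_le_of_isEquivalent hk₂ hρ_asymp) hT)
  · by_contra hκ1
    exact hβ.ne (top_of_le (not_lt.1 hκ1))
  · have hl2 : 0 < (c * g 0 - f 0) / 2 := half_pos (sub_pos.2 hl)
    exact hu.lt_top_of_bound hTanti hTI hTu (exists_bound_of_le_rpow hT
      (Real.rpow_nonneg (by positivity) q) hκ1
      (eventually_rpow_le_mul_rpow hd_asymp hk₁ hd_pos hq.le hl2 (lower_of_lt hκ hl)))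
  · have := (tendsto_div_zero_of_le_mul hd_asymp hk₁ hδ hyA).rpow_const (p := q) (Or.inr hq.le)
    simpa [Real.zero_rpow hq.ne'] using this.neg
  -- For `δ = 1`, `κ = 0 < r`, so the critical-speed slope applies if `l > 0`; if `l = 0`,
  -- positivity and the upper bound suffice.
  · have hslope : Tendsto (fun s => y s / s) (𝓝[>] 0) (𝓝 (c * g 0 - f 0)) := by
      rcases hl0.eq_or_lt with hl | hl
      · rw [← hl] at hh ⊢
        refine tendsto_order.2 ⟨fun a ha => ?_, fun a ha => ?_⟩
        · filter_upwards [hyA, self_mem_nhdsWithin] with s hs hs0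
          exact ha.trans (div_pos hs.1 hs0)
        · filter_upwards [hy.eventually_le_mul hφ h0 hh (half_pos ha), self_mem_nhdsWithin]
            with s hs hs0
          have hs0 : 0 < s := hs0
          rw [div_lt_iff₀ hs0]
          nlinarith
      · exact slope_of_lt (by rw [hδ]; simpa using hr) (sub_pos.1 hl)
    refine ⟨-((c * g 0 - f 0) / k₁) ^ q, deriv_tendsto
      ((tendsto_div_of_isEquivalent hd_asymp hk₁ hδ hslope).rpow_const (Or.inr hq.le)).neg, ?_⟩
    rw [neg_eq_zero, Real.rpow_eq_zero (div_nonneg hl0 hk₁.le) hq.ne', div_eq_zero_iff]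
    exact or_iff_left hk₁.ne'
  · have hl2 : 0 < (c * g 0 - f 0) / 2 := half_pos (sub_pos.2 hl)
    have hκ : (1 - δ) * q < r :=
      (mul_neg_of_neg_of_pos (sub_neg.2 hδ) hq).trans hr
    exact tendsto_neg_atTop_atBot.comp ((tendsto_rpow_atTop hq).comp
      (tendsto_div_atTop_of_mul_le hd_asymp hk₁ hd_pos hδ hl2 (lower_of_lt hκ hl)))
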